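/- Let $n$ be the space dimension and $1\le p<\infty$. For $x\in\mathbb R^n$, $t\in\mathbb R$, $L>0$ let $Q(x,L)=\{y\in\mathbb R^n: |y_i-x_i|\le L/2,\ i=1,\dots,n\}$, let $R=Q(x,L)\times(t-L^p,t+L^p)$ be the parabolic rectangle with center $(x,t)$ and side length $L$, and put $R^-=Q(x,L)\times(t-L^p,t)$ and $R^+=Q(x,L)\times(t,t+L^p)$. A weight is a locally integrable nonnegative function on $\mathbb R^{n+1}$, and $f_A=|A|^{-1}\int_A f\in[0,\infty]$ is the integral average of $f\ge 0$ with respect to Lebesgue measure. For $1<q<\infty$, a weight $w$ belongs to $RH^+_q$ if there is a constant $C>0$ such that $\bigl((w^q)_{R^-}\bigr)^{1/q}\le C\,w_{R^+}$ for every parabolic rectangle $R\subset\mathbb R^{n+1}$. Theorem (parabolic Gehring lemma). Let $1<q<\infty$ and $C_1>0$. Then there exist $\varepsilon=\varepsilon(n,q,C_1)>0$ and $C=C(n,q,C_1)>0$, not depending on $p$ or $w$, such that the following holds for every $1\le p<\infty$. If $w$ is a weight with $$\Bigl((w^q)_{R^-}\Bigr)^{1/q}\le C_1 w_{R^+}$$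 for every parabolic rectangle $R\subset\mathbb R^{n+1}$, then $$\Bigl((w^{q+\varepsilon})_{R^-}\Bigr)^{1/(q+\varepsilon)}\le C w_{R^+}$$ for every parabolic rectangle $R\subset\mathbb R^{n+1}$. In particular, for every $1\le p<\infty$ and every $w\in RH^+_q$ there is $\varepsilon>0$ such that $w\in RH^+_{q+\varepsilon}$. -/

import Mathlib

open MeasureTheory

/-- The closed spatial cube `Q(x, L)` in `ℝⁿ` with center `x` and side length `L`. -/
def spatialCube {n : ℕ} (x : Fin n → ℝ) (L : ℝ) : Set (Fin n → ℝ) :=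
  {y | ∀ i, |y i - x i| ≤ L / 2}

/-- The lower part `R⁻ = Q(x, L) × (t - L ^ p, t)` (zero time lag) of the parabolic rectangle
`R = Q(x, L) × (t - L ^ p, t + L ^ p)`. -/
def lowerRect {n : ℕ} (p : ℝ) (x : Fin n → ℝ) (t L : ℝ) : Set ((Fin n → ℝ) × ℝ) :=
  spatialCube x L ×ˢ Set.Ioo (t - L ^ p) t

/-- The upper part `R⁺ = Q(x, L) × (t, t + L ^ p)` (zero time lag) of the parabolic rectangle
`R = Q(x, L) × (t - L ^ p, t + L ^ p)`. -/
def upperRect {n : ℕ} (p : ℝ) (x : Fin n → ℝ) (t L : ℝ) : Set ((Fin n → ℝ) × ℝ) :=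
  spatialCube x L ×ˢ Set.Ioo t (t + L ^ p)

/-- A weight on `ℝⁿ⁺¹ = ℝⁿ × ℝ`: a locally integrable nonnegative function. -/
def IsWeight {n : ℕ} (w : (Fin n → ℝ) × ℝ → ℝ) : Prop :=
  LocallyIntegrable w volume ∧ ∀ z, 0 ≤ w z

/-- The parabolic reverse Hölder inequality with exponent `q` and constant `C`, for every
parabolic rectangle. The averages are taken in `[0, ∞]`, so that the finiteness of the
left-hand side is part of the inequality. -/
def ParabolicReverseHolder {n : ℕ} (p q C : ℝ) (w : (Fin n → ℝ) × ℝ → ℝ) : Prop :=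
  ∀ (x : Fin n → ℝ) (t L : ℝ), 0 < L →
    (⨍⁻ z in lowerRect p x t L, ENNReal.ofReal (w z ^ q) ∂volume) ^ (1 / q) ≤
      ENNReal.ofReal C * ⨍⁻ z in upperRect p x t L, ENNReal.ofReal (w z) ∂volume

/-- The parabolic reverse Hölder class `RH⁺_q` on `ℝⁿ⁺¹` (for the geometry with exponent `p`). -/
def RHPlus (n : ℕ) (p q : ℝ) : Set ((Fin n → ℝ) × ℝ → ℝ) :=
  {w | IsWeight w ∧ ∃ C : ℝ, 0 < C ∧ ParabolicReverseHolder p q C w}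

/-!
The proof is a Gehring type argument that moves forward in time only.

The constants are independent of `p` because of the choice of the dyadic grid. Halving the spatial
sides of a parabolic rectangle divides its duration by `2 ^ p`, which is out of control for large
`p`. Instead, each generation of `parabolicGrid` halves the durations and only about one generation
in `p` halves the spatial sides, so that a cell has at most `2 ^ (n + 1)` children
(`SpaceTimeGrid`). The side length of a cell is at most four times that of the parabolic rectangle
with the same duration. A cell is therefore covered by a number of parabolic rectangles depending
only on `n`, and the reverse Hölder inequality passes to the cells
(`ParabolicReverseHolder.boxReverseHolder_parabolicGrid`).

For a level `l`, consider the maximal cells `P` on which, together with the next cell in time, the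
average of `w ^ q` exceeds `l ^ q`. Two applications of the reverse Hölder inequality move this
excess to the cell two steps after `P` (`SpaceTimeGrid.level_mul_vol_le`). The latter cells may
overlap, but they are dyadic, so the maximal ones among them are disjoint, and the cells `P` that
belong to such a maximal cell lie in a region on which the maximality of `P` controls the mass of
`w ^ q` (`SpaceTimeGrid.lintegral_superlevel_le`). This gives
`∫_{w > l} w ^ q ≤ K * l ^ (q - 1) * ∫_{w > l / κ} w`, where the integral on the right is over a
region prolonged forward in time by a few durations of the stopping cells
(`SpaceTimeGrid.lintegral_superlevel_slab_le`).

Integration against `l ^ (ε - 1)` estimates the integral of `w ^ (q + ε)` over a region by its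
integral over a longer region, times a factor of order `ε`. Higher levels force smaller stopping
cells, so the prolongations can be made to shrink geometrically, at the price of error terms that
grow geometrically. For small `ε` the factor beats this growth, and iteration, with a truncation
that keeps all integrals finite, gives the local estimate
`SpaceTimeGrid.lintegral_slab_rpow_add_le`. Finally both parts of a parabolic rectangle are halved
in time, and the averages of `w ^ q` in the local estimate are moved forward to the last quarter of
the rectangle (`ParabolicReverseHolder.laverage_rpow_add_le`).
-/

open Filter Topology
open scoped ENNReal

/-! ### Half-open boxes -/

/-- The half-open space-time box with lower corner `(b, c)`, spatial side length `L` and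
duration `h`. -/
def halfOpenBox {n : ℕ} (b : Fin n → ℝ) (L c h : ℝ) : Set ((Fin n → ℝ) × ℝ) :=
  (Set.univ.pi fun i => Set.Ico (b i) (b i + L)) ×ˢ Set.Ico c (c + h)

lemma mem_halfOpenBox {n : ℕ} {b : Fin n → ℝ} {L c h : ℝ} {z : (Fin n → ℝ) × ℝ} :
    z ∈ halfOpenBox b L c h ↔
      (∀ i, b i ≤ z.1 i ∧ z.1 i < b i + L) ∧ c ≤ z.2 ∧ z.2 < c + h := by
  simp [halfOpenBox, Set.mem_prod, Set.mem_pi]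

lemma measurableSet_halfOpenBox {n : ℕ} (b : Fin n → ℝ) (L c h : ℝ) :
    MeasurableSet (halfOpenBox b L c h) :=
  (MeasurableSet.univ_pi fun _ => measurableSet_Ico).prod measurableSet_Ico

lemma volume_halfOpenBox {n : ℕ} (b : Fin n → ℝ) {L : ℝ} (hL : 0 ≤ L) (c h : ℝ) :
    volume (halfOpenBox b L c h) = ENNReal.ofReal (L ^ n * h) := by
  rw [halfOpenBox, Measure.volume_eq_prod, Measure.prod_prod, Real.volume_pi_Ico, Real.volume_Ico,
    ENNReal.ofReal_mul (by positivity), ENNReal.ofReal_pow hL]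
  simp

/-! ### Dyadic grids in space-time -/

/-- A dyadic grid of half-open boxes in space-time. Every generation halves the durations and
either keeps or halves the spatial side lengths, so a cell has at most `2 ^ (n + 1)` children
whatever the ratio of the spatial to the temporal scaling is. -/
structure SpaceTimeGrid (n : ℕ) where
  /-- The spatial corner at which the grid is anchored. -/
  corner : Fin n → ℝ
  /-- The time at which the grid is anchored. -/
  start : ℝ
  /-- The spatial side length of the cells of each generation. -/
  side : ℕ → ℝ
  /-- The duration of the cells of each generation. -/
  dur : ℕ → ℝ
  side_pos : ∀ j, 0 < side j
  dur_pos : ∀ j, 0 < dur j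
  side_succ : ∀ j, side (j + 1) = side j ∨ side (j + 1) = side j / 2
  dur_succ : ∀ j, dur (j + 1) = dur j / 2
  side_tendsto : Tendsto side atTop (𝓝 0)

namespace SpaceTimeGrid

variable {n : ℕ} (G : SpaceTimeGrid n)

/-- The integer coordinates of the cell of generation `j` that contains `z`. -/
noncomputable def idx (j : ℕ) (z : (Fin n → ℝ) × ℝ) : (Fin n → ℤ) × ℤ :=
  (fun i => ⌊(z.1 i - G.corner i) / G.side j⌋, ⌊(z.2 - G.start) / G.dur j⌋)

/-- The lower corner of the cell of generation `j` with coordinates `c`. -/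
noncomputable def pt (j : ℕ) (c : (Fin n → ℤ) × ℤ) : (Fin n → ℝ) × ℝ :=
  (fun i => G.corner i + G.side j * c.1 i, G.start + G.dur j * c.2)

/-- The cell of generation `j` with integer coordinates `c`. -/
noncomputable def cell (j : ℕ) (c : (Fin n → ℤ) × ℤ) : Set ((Fin n → ℝ) × ℝ) :=
  halfOpenBox (G.pt j c).1 (G.side j) (G.pt j c).2 (G.dur j)

/-- The common volume of the cells of generation `j`. -/
noncomputable def vol (j : ℕ) : ℝ≥0∞ := ENNReal.ofReal (G.side j ^ n * G.dur j)

/-- Translation of the coordinates of a cell by `k` cells in time. -/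
def later (k : ℤ) (c : (Fin n → ℤ) × ℤ) : (Fin n → ℤ) × ℤ := (c.1, c.2 + k)

lemma later_later (k l : ℤ) (c : (Fin n → ℤ) × ℤ) : later k (later l c) = later (l + k) c := by
  simp [later, add_assoc]

lemma later_zero (c : (Fin n → ℤ) × ℤ) : later 0 c = c := by simp [later]

lemma volume_cell (j : ℕ) (c : (Fin n → ℤ) × ℤ) : volume (G.cell j c) = G.vol j :=
  volume_halfOpenBox _ (G.side_pos j).le _ _

lemma measurableSet_cell (j : ℕ) (c : (Fin n → ℤ) × ℤ) : MeasurableSet (G.cell j c) :=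
  measurableSet_halfOpenBox _ _ _ _

lemma vol_pos (j : ℕ) : 0 < G.vol j :=
  ENNReal.ofReal_pos.2 (mul_pos (pow_pos (G.side_pos j) _) (G.dur_pos j))

lemma vol_ne_top (j : ℕ) : G.vol j ≠ ∞ := ENNReal.ofReal_ne_top

lemma mem_cell_iff {j : ℕ} {c : (Fin n → ℤ) × ℤ} {z : (Fin n → ℝ) × ℝ} :
    z ∈ G.cell j c ↔ G.idx j z = c := by
  have key : ∀ (r y s : ℝ) (m : ℤ), 0 < s →
      (r + s * m ≤ y ∧ y < r + s * m + s ↔ ⌊(y - r) / s⌋ = m) := by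
    intro r y s m hs
    rw [Int.floor_eq_iff, le_div_iff₀ hs, div_lt_iff₀ hs]
    constructor <;> rintro ⟨h1, h2⟩ <;> constructor <;> linarith
  rw [cell, mem_halfOpenBox, Prod.ext_iff, funext_iff]
  simp only [pt, idx]
  exact and_congr (forall_congr' fun i => key _ _ _ _ (G.side_pos j)) (key _ _ _ _ (G.dur_pos j))

lemma mem_cell_idx (j : ℕ) (z : (Fin n → ℝ) × ℝ) : z ∈ G.cell j (G.idx j z) :=
  G.mem_cell_iff.2 rfl

lemma idx_pt (j : ℕ) (c : (Fin n → ℤ) × ℤ) : G.idx j (G.pt j c) = c := by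
  have := (G.dur_pos j).ne'
  have := (G.side_pos j).ne'
  ext <;> simp [idx, pt, *]

/-- The cells of generation `j + 1` are nested in the cells of generation `j`. -/
lemma idx_eq_of_idx_succ_eq {j : ℕ} {y z : (Fin n → ℝ) × ℝ}
    (h : G.idx (j + 1) y = G.idx (j + 1) z) : G.idx j y = G.idx j z := by
  have half : ∀ r s : ℝ, ⌊r / s⌋ = ⌊r / (s / 2)⌋ / 2 := by
    intro r s
    have h1 : r / s = r / (s / 2) / ((2 : ℕ) : ℝ) := by
      push_cast
      rw [div_div, div_mul_cancel₀ s two_ne_zero]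
    rw [h1, Int.floor_div_natCast]
    rfl
  rw [idx, idx, Prod.mk.injEq, funext_iff] at h ⊢
  refine ⟨fun i => ?_, ?_⟩
  · have hi := h.1 i
    rcases G.side_succ j with hs | hs <;> rw [hs] at hi
    · exact hi
    · rw [half _ (G.side j), half (z.1 i - _) (G.side j), hi]
  · have ht := h.2
    rw [G.dur_succ] at ht
    rw [half _ (G.dur j), half (z.2 - _) (G.dur j), ht]

lemma idx_eq_of_le {i j : ℕ} (hij : i ≤ j) {y z : (Fin n → ℝ) × ℝ}
    (h : G.idx j y = G.idx j z) : G.idx i y = G.idx i z := by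
  induction j, hij using Nat.le_induction with
  | base => exact h
  | succ j _ ih => exact ih (G.idx_eq_of_idx_succ_eq h)

lemma dur_le_of_le {i j : ℕ} (hij : i ≤ j) : G.dur j ≤ G.dur i := by
  induction j, hij using Nat.le_induction with
  | base => exact le_rfl
  | succ j _ ih =>
    rw [G.dur_succ]
    linarith [G.dur_pos j]

lemma dur_eq (j : ℕ) : G.dur j = G.dur 0 / 2 ^ j := by
  induction j with
  | zero => simp
  | succ j ih => rw [G.dur_succ, ih, pow_succ, div_div]

lemma vol_le_mul_vol_succ (j : ℕ) : G.vol j ≤ 2 ^ (n + 1) * G.vol (j + 1) := by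
  have hs : G.side j ≤ 2 * G.side (j + 1) := by
    have := G.side_pos j
    rcases G.side_succ j with h | h <;> rw [h] <;> linarith
  have hd : G.dur j = 2 * G.dur (j + 1) := by rw [G.dur_succ]; ring
  have : G.side j ^ n * G.dur j ≤ 2 ^ (n + 1) * (G.side (j + 1) ^ n * G.dur (j + 1)) := by
    calc G.side j ^ n * G.dur j ≤ (2 * G.side (j + 1)) ^ n * (2 * G.dur (j + 1)) := by
          rw [hd]
          have := G.dur_pos (j + 1)
          gcongr
          exact (G.side_pos j).le
      _ = _ := by rw [mul_pow, pow_succ]; ring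
  calc G.vol j ≤ ENNReal.ofReal (2 ^ (n + 1) * (G.side (j + 1) ^ n * G.dur (j + 1))) :=
        ENNReal.ofReal_le_ofReal this
    _ = _ := by
      rw [ENNReal.ofReal_mul (by positivity), ENNReal.ofReal_pow (by norm_num)]
      simp [vol]

lemma vol_zero_le (j : ℕ) : G.vol 0 ≤ (2 ^ (n + 1)) ^ j * G.vol j := by
  induction j with
  | zero => simp
  | succ j ih =>
    calc G.vol 0 ≤ (2 ^ (n + 1)) ^ j * G.vol j := ih
      _ ≤ (2 ^ (n + 1)) ^ j * (2 ^ (n + 1) * G.vol (j + 1)) := by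
        gcongr
        exact G.vol_le_mul_vol_succ j
      _ = _ := by rw [pow_succ (2 ^ (n + 1)), mul_assoc]

/-- From any family of cells, the maximal ones form a pairwise disjoint family with the same
union. -/
lemma exists_maximal_cells (S : ℕ → (Fin n → ℤ) × ℤ → Prop) :
    ∃ T : Set (ℕ × ((Fin n → ℤ) × ℤ)), (∀ τ ∈ T, S τ.1 τ.2) ∧
      (Pairwise fun τ σ : T => Disjoint (G.cell τ.1.1 τ.1.2) (G.cell σ.1.1 σ.1.2)) ∧
      ∀ j z, S j (G.idx j z) → ∃ i ≤ j, (i, G.idx i z) ∈ T := by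
  classical
  refine ⟨{τ | S τ.1 τ.2 ∧ ∀ i < τ.1, ¬ S i (G.idx i (G.pt τ.1 τ.2))}, fun τ h => h.1, ?_, ?_⟩
  · have aux : ∀ (i j : ℕ) (c d : (Fin n → ℤ) × ℤ) (y : (Fin n → ℝ) × ℝ), i < j → S i c →
        (∀ k < j, ¬ S k (G.idx k (G.pt j d))) → y ∈ G.cell i c → y ∈ G.cell j d → False := by
      intro i j c d y hij hS hd hyc hyd
      rw [mem_cell_iff] at hyc hyd
      have : G.idx i (G.pt j d) = G.idx i y :=
        G.idx_eq_of_le hij.le (by rw [G.idx_pt, hyd])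
      exact hd i hij (by rwa [this, hyc])
    rintro ⟨⟨i, c⟩, hi⟩ ⟨⟨j, d⟩, hj⟩ hne
    refine Set.disjoint_left.2 fun y hyc hyd => ?_
    rcases lt_trichotomy i j with h | h | h
    · exact aux i j c d y h hi.1 hj.2 hyc hyd
    · subst h
      apply hne
      simp only at hyc hyd
      rw [mem_cell_iff] at hyc hyd
      simp [← hyc, ← hyd]
    · exact aux j i d c y h hj.1 hi.2 hyd hyc
  · intro j z hS
    have hex : ∃ i, S i (G.idx i z) := ⟨j, hS⟩
    refine ⟨Nat.find hex, Nat.find_min' hex hS, Nat.find_spec hex, fun i hi => ?_⟩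
    have := Nat.find_min hex hi
    rwa [G.idx_eq_of_le hi.le (G.idx_pt _ (G.idx (Nat.find hex) z))]

lemma dur_tendsto : Tendsto G.dur atTop (𝓝 0) := by
  have h : G.dur = fun j => G.dur 0 * (1 / 2 : ℝ) ^ j := by
    funext j
    rw [G.dur_eq, one_div, inv_pow, div_eq_mul_inv]
  rw [h]
  simpa using (tendsto_pow_atTop_nhds_zero_of_lt_one (by norm_num : (0 : ℝ) ≤ 1 / 2)
    (by norm_num)).const_mul (G.dur 0)

lemma exists_cell_subset {U : Set ((Fin n → ℝ) × ℝ)} (hU : IsOpen U) {z : (Fin n → ℝ) × ℝ}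
    (hz : z ∈ U) : ∃ j, G.cell j (G.idx j z) ⊆ U := by
  obtain ⟨r, hr, hball⟩ := Metric.isOpen_iff.1 hU z hz
  obtain ⟨j, hj1, hj2⟩ := ((G.side_tendsto.eventually (gt_mem_nhds hr)).and
    (G.dur_tendsto.eventually (gt_mem_nhds hr))).exists
  refine ⟨j, fun y hy => hball ?_⟩
  have hz' := mem_halfOpenBox.1 (G.mem_cell_idx j z)
  have hy' := mem_halfOpenBox.1 hy
  rw [Metric.mem_ball, Prod.dist_eq, max_lt_iff]
  refine ⟨(dist_pi_lt_iff hr).2 fun i => ?_, ?_⟩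
  · have h1 := hz'.1 i
    have h2 := hy'.1 i
    rw [Real.dist_eq, abs_lt]
    constructor <;> linarith
  · have h1 := hz'.2
    have h2 := hy'.2
    rw [Real.dist_eq, abs_lt]
    constructor <;> linarith

/-! ### The forward-in-time Calderón–Zygmund estimate -/

/-- The dyadic Lebesgue differentiation theorem, in the form of a bound: a function is at most
`Λ` almost everywhere on the set where all its cell averages are at most `Λ`. -/
lemma ae_le_of_forall_cell_le {v : (Fin n → ℝ) × ℝ → ℝ≥0∞} (hv : Measurable v) {Λ : ℝ≥0∞}
    (hΛ₀ : Λ ≠ 0) (hΛ : Λ ≠ ∞) :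
    ∀ᵐ z, (∀ j, ∫⁻ y in G.cell j (G.idx j z), v y ≤ Λ * G.vol j) → v z ≤ Λ := by
  set N : Set ((Fin n → ℝ) × ℝ) :=
    {z | ∀ j, ∫⁻ y in G.cell j (G.idx j z), v y ≤ Λ * G.vol j} with hN
  have hNm : MeasurableSet N := by
    have : ∀ j, Measurable (G.idx j) := by
      intro j
      unfold idx
      fun_prop
    rw [hN, Set.ofPred_forall]
    refine MeasurableSet.iInter fun j => ?_
    exact this j (Set.to_countable
      {c | ∫⁻ y in G.cell j c, v y ≤ Λ * G.vol j}).measurableSet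
  suffices h : ∀ᵐ z ∂(volume.restrict N), v z ≤ Λ from (ae_restrict_iff' hNm).1 h
  refine ae_le_of_forall_setLIntegral_le_of_sigmaFinite hv fun s hs _ => ?_
  rw [Measure.restrict_restrict hs, setLIntegral_const,
    Set.measure_eq_iInf_isOpen (s ∩ N)]
  simp_rw [ENNReal.mul_iInf_of_ne hΛ₀ hΛ]
  refine le_iInf fun U => le_iInf fun hsU => le_iInf fun hU => ?_
  obtain ⟨T, hTS, hdisj, hcov⟩ := G.exists_maximal_cells
    fun j c => G.cell j c ⊆ U ∧ ∫⁻ y in G.cell j c, v y ≤ Λ * G.vol j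
  have hsub : s ∩ N ⊆ ⋃ τ : T, G.cell τ.1.1 τ.1.2 := by
    intro z hz
    obtain ⟨j, hj⟩ := G.exists_cell_subset hU (hsU hz)
    obtain ⟨i, -, hi⟩ := hcov j z ⟨hj, hz.2 j⟩
    exact Set.mem_iUnion.2 ⟨⟨_, hi⟩, G.mem_cell_idx i z⟩
  calc ∫⁻ z in s ∩ N, v z ≤ ∫⁻ z in ⋃ τ : T, G.cell τ.1.1 τ.1.2, v z := lintegral_mono_set hsub
    _ ≤ ∑' τ : T, ∫⁻ z in G.cell τ.1.1 τ.1.2, v z := lintegral_iUnion_le _ _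
    _ ≤ ∑' τ : T, Λ * volume (G.cell τ.1.1 τ.1.2) := by
      refine ENNReal.tsum_le_tsum fun τ => ?_
      rw [G.volume_cell]
      exact (hTS _ τ.2).2
    _ = Λ * volume (⋃ τ : T, G.cell τ.1.1 τ.1.2) := by
      rw [ENNReal.tsum_mul_left,
        measure_iUnion hdisj fun τ => G.measurableSet_cell τ.1.1 τ.1.2]
    _ ≤ Λ * volume U := by
      gcongr
      exact Set.iUnion_subset fun τ => (hTS _ τ.2).1

/-- Moving a point forward in time by two cells of a finer generation moves it forward by at most
two cells of a coarser generation. -/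
lemma exists_later_idx {i j : ℕ} (hij : i ≤ j) (z : (Fin n → ℝ) × ℝ) :
    ∃ k : ℤ, 0 ≤ k ∧ k ≤ 2 ∧ G.idx i (z.1, z.2 + 2 * G.dur j) = later k (G.idx i z) := by
  have hi := G.dur_pos i
  have hj := G.dur_pos j
  have hle := G.dur_le_of_le hij
  refine ⟨⌊(z.2 + 2 * G.dur j - G.start) / G.dur i⌋ - ⌊(z.2 - G.start) / G.dur i⌋, ?_, ?_, ?_⟩
  · rw [sub_nonneg]
    apply Int.floor_le_floor
    gcongr
    linarith
  · rw [sub_le_iff_le_add', ← Int.floor_add_ofNat]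
    apply Int.floor_le_floor
    rw [div_add' _ _ _ hi.ne']
    gcongr
    linarith
  · simp [idx, later]

lemma idx_add_two_dur (j : ℕ) (z : (Fin n → ℝ) × ℝ) :
    G.idx j (z.1, z.2 + 2 * G.dur j) = later 2 (G.idx j z) := by
  have hj := (G.dur_pos j).ne'
  have : (z.2 + 2 * G.dur j - G.start) / G.dur j = (z.2 - G.start) / G.dur j + 2 := by
    field_simp
    ring
  simp [idx, later, this]

/-- A cell and its two successors in time lie in the parent cell or its successor in time. -/
lemma cell_later_subset (j : ℕ) (c : (Fin n → ℤ) × ℤ) {k : ℤ} (hk₀ : 0 ≤ k) (hk₂ : k ≤ 2) :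
    G.cell (j + 1) (later k c) ⊆ G.cell j (G.idx j (G.pt (j + 1) c)) ∪
      G.cell j (later 1 (G.idx j (G.pt (j + 1) c))) := by
  intro y hy
  have hd := G.dur_pos (j + 1)
  have hd2 : G.dur j = 2 * G.dur (j + 1) := by rw [G.dur_succ]; ring
  rw [mem_cell_iff] at hy
  have hpy : G.idx j y = G.idx j (G.pt (j + 1) (later k c)) :=
    G.idx_eq_of_idx_succ_eq (by rw [hy, idx_pt])
  have htime : ∀ d, (G.idx j (G.pt (j + 1) d)).2 = d.2 / 2 := by
    intro d
    have : ((G.pt (j + 1) d).2 - G.start) / G.dur j = (d.2 : ℝ) / ((2 : ℕ) : ℝ) := by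
      rw [hd2]
      simp only [pt]
      push_cast
      field_simp
      ring
    simp only [idx]
    rw [this, Int.floor_div_natCast, Int.floor_intCast]
    rfl
  have hcases : (c.2 + k) / 2 = c.2 / 2 ∨ (c.2 + k) / 2 = c.2 / 2 + 1 := by omega
  refine hcases.imp (fun h => ?_) (fun h => ?_) <;> rw [mem_cell_iff, hpy]
  · refine Prod.ext rfl ?_
    rw [htime, htime]
    exact h
  · refine Prod.ext rfl ?_
    change (G.idx j _).2 = (G.idx j _).2 + 1
    rw [htime, htime]
    exact h

/-- The forward-in-time Calderón--Zygmund estimate. If the mass of `v` on a cell and its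
successor in time can exceed `Λ` times the volume of a cell only where the mass of `u` on the
next cell is at least that large, then `u` controls `v` on its superlevel set.

The superlevel set is covered by the maximal cells `P` at which the threshold is exceeded. The
cells `later 2 P` may overlap, but the maximal ones among them are disjoint, and all of the
cells `P` with `later 2 P` inside a given maximal cell `F` lie in `F` or one of the two cells
preceding it, where maximality of the cell two steps before `F` bounds the mass of `v`. -/
lemma lintegral_superlevel_le {v u : (Fin n → ℝ) × ℝ → ℝ≥0∞} (hv : Measurable v)
    {Λ : ℝ≥0∞} (hΛ₀ : Λ ≠ 0) (hΛ : Λ ≠ ∞) (hroot : ∫⁻ z, v z ≤ Λ * G.vol 0)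
    (hstep : ∀ j c, Λ * G.vol j < ∫⁻ z in G.cell j c ∪ G.cell j (later 1 c), v z →
      Λ * G.vol j ≤ ∫⁻ z in G.cell j (later 2 c), u z) :
    ∫⁻ z in {z | Λ < v z}, v z ≤ 2 ^ (n + 1) * ∫⁻ z, u z := by
  classical
  set bad : ℕ → (Fin n → ℤ) × ℤ → Prop := fun j c =>
    Λ * G.vol j < ∫⁻ z in G.cell j c ∪ G.cell j (later 1 c), v z with hbad
  have hbad0 : ∀ c, ¬ bad 0 c := fun c h =>
    absurd (h.trans_le (setLIntegral_le_lintegral _ _)) (not_lt.2 hroot)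
  set first : ℕ → (Fin n → ℤ) × ℤ → Prop := fun j c =>
    bad j c ∧ ∀ i < j, ¬ bad i (G.idx i (G.pt j c)) with hfirst
  obtain ⟨T, hTS, hdisj, hcov⟩ := G.exists_maximal_cells fun j c => first j (later (-2) c)
  set W : T → Set ((Fin n → ℝ) × ℝ) := fun τ =>
    G.cell τ.1.1 (later (-2) τ.1.2) ∪ G.cell τ.1.1 (later (-1) τ.1.2) ∪ G.cell τ.1.1 τ.1.2 with hW
  have hsub : ∀ᵐ z, z ∈ {z | Λ < v z} → z ∈ ⋃ τ, W τ := by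
    filter_upwards [G.ae_le_of_forall_cell_le hv hΛ₀ hΛ] with z hz hlt
    have hex : ∃ j, bad j (G.idx j z) := by
      by_contra! hno
      refine absurd (hz fun j => ?_) (not_le.2 hlt)
      exact (lintegral_mono_set Set.subset_union_left).trans (not_lt.1 (hno j))
    have hst : first (Nat.find hex) (G.idx (Nat.find hex) z) := by
      refine ⟨Nat.find_spec hex, fun i hi => ?_⟩
      have := Nat.find_min hex hi
      rwa [G.idx_eq_of_le hi.le (G.idx_pt _ (G.idx (Nat.find hex) z))]
    generalize Nat.find hex = j at hst
    obtain ⟨i, hij, hi⟩ := hcov j (z.1, z.2 + 2 * G.dur j) (by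
      rw [idx_add_two_dur, later_later]
      simpa [later_zero] using hst)
    obtain ⟨k, hk0, hk2, hk⟩ := G.exists_later_idx hij z
    rw [hk] at hi
    refine Set.mem_iUnion.2 ⟨⟨_, hi⟩, ?_⟩
    simp only [hW, Set.mem_union, mem_cell_iff, later_later]
    have : k = 0 ∨ k = 1 ∨ k = 2 := by omega
    rcases this with rfl | rfl | rfl
    · exact Or.inr (later_zero _).symm
    · exact Or.inl (Or.inr (later_zero _).symm)
    · exact Or.inl (Or.inl (later_zero _).symm)
  have hWle : ∀ τ : T, ∫⁻ z in W τ, v z ≤ 2 ^ (n + 1) * ∫⁻ z in G.cell τ.1.1 τ.1.2, u z := by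
    rintro ⟨⟨j, c⟩, hτ⟩
    obtain ⟨hb, hp⟩ := hTS _ hτ
    simp only at hb hp
    obtain ⟨d, rfl⟩ : ∃ d, c = later 2 d := ⟨later (-2) c, by simp [later_later, later_zero]⟩
    have hd : later (-2) (later 2 d) = d := by simp [later_later, later_zero]
    have hd1 : later (-1) (later 2 d) = later 1 d := by simp [later_later]
    rw [hd] at hb hp
    rcases j with _ | j
    · exact absurd hb (hbad0 _)
    have hsubW : W ⟨⟨j + 1, later 2 d⟩, hτ⟩ ⊆ G.cell j (G.idx j (G.pt (j + 1) d)) ∪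
        G.cell j (later 1 (G.idx j (G.pt (j + 1) d))) := by
      simp only [hW, hd, hd1]
      refine Set.union_subset (Set.union_subset ?_ ?_) ?_
      · simpa [later_zero] using G.cell_later_subset j d (k := 0) (by norm_num) (by norm_num)
      · exact G.cell_later_subset j d (by norm_num) (by norm_num)
      · exact G.cell_later_subset j d (by norm_num) (by norm_num)
    calc _ ≤ _ := lintegral_mono_set hsubW
      _ ≤ Λ * G.vol j := not_lt.1 (hp j (Nat.lt_succ_self j))
      _ ≤ Λ * (2 ^ (n + 1) * G.vol (j + 1)) := by
        gcongr
        exact G.vol_le_mul_vol_succ j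
      _ = 2 ^ (n + 1) * (Λ * G.vol (j + 1)) := by ring
      _ ≤ _ := by
        gcongr
        exact hstep _ _ hb
  calc ∫⁻ z in {z | Λ < v z}, v z ≤ ∫⁻ z in ⋃ τ, W τ, v z := lintegral_mono_set' hsub
    _ ≤ ∑' τ, ∫⁻ z in W τ, v z := lintegral_iUnion_le _ _
    _ ≤ ∑' τ : T, 2 ^ (n + 1) * ∫⁻ z in G.cell τ.1.1 τ.1.2, u z := ENNReal.tsum_le_tsum hWle
    _ = 2 ^ (n + 1) * ∫⁻ z in ⋃ τ : T, G.cell τ.1.1 τ.1.2, u z := by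
      rw [ENNReal.tsum_mul_left,
        lintegral_iUnion (fun τ : T => G.measurableSet_cell τ.1.1 τ.1.2) hdisj]
    _ ≤ _ := by
      gcongr
      exact Measure.restrict_le_self

end SpaceTimeGrid

/-! ### The reverse Hölder inequality on boxes and on the cells of a parabolic grid -/

/-- The one-sided reverse Hölder inequality with exponent `q` and constant `C` on all half-open
boxes of spatial side length `L` and duration `h`. -/
def BoxReverseHolder {n : ℕ} (u : (Fin n → ℝ) × ℝ → ℝ≥0∞) (q : ℝ) (C : ℝ≥0∞) (L h : ℝ) : Prop :=
  ∀ (b : Fin n → ℝ) (c : ℝ),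
    (⨍⁻ z in halfOpenBox b L c h, u z ^ q ∂volume) ^ (1 / q) ≤
      C * ⨍⁻ z in halfOpenBox b L (c + h) h, u z ∂volume

lemma volume_halfOpenBox_ne_zero {n : ℕ} (b : Fin n → ℝ) {L h : ℝ} (hL : 0 < L) (c : ℝ)
    (hh : 0 < h) : volume (halfOpenBox b L c h) ≠ 0 := by
  rw [volume_halfOpenBox b hL.le]
  exact (ENNReal.ofReal_pos.2 (mul_pos (pow_pos hL _) hh)).ne'

lemma volume_halfOpenBox_ne_top {n : ℕ} (b : Fin n → ℝ) {L h : ℝ} (hL : 0 < L) (c : ℝ) :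
    volume (halfOpenBox b L c h) ≠ ∞ := by
  rw [volume_halfOpenBox b hL.le]
  exact ENNReal.ofReal_ne_top

lemma laverage_halfOpenBox {n : ℕ} (u : (Fin n → ℝ) × ℝ → ℝ≥0∞) (b : Fin n → ℝ) {L : ℝ}
    (hL : 0 < L) (c h : ℝ) :
    ⨍⁻ z in halfOpenBox b L c h, u z ∂volume =
      (∫⁻ z in halfOpenBox b L c h, u z) / ENNReal.ofReal (L ^ n * h) := by
  rw [setLAverage_eq, volume_halfOpenBox b hL.le]

/-- Jensen's inequality for averages. -/
lemma laverage_le_laverage_rpow {α : Type*} [MeasurableSpace α] {μ : Measure α} {s : Set α}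
    (h₀ : μ s ≠ 0) (h₁ : μ s ≠ ∞) {u : α → ℝ≥0∞} (hu : Measurable u) {q : ℝ} (hq : 1 ≤ q) :
    ⨍⁻ z in s, u z ∂μ ≤ (⨍⁻ z in s, u z ^ q ∂μ) ^ (1 / q) := by
  have : IsProbabilityMeasure ((μ.restrict s Set.univ)⁻¹ • μ.restrict s) := by
    constructor
    simp [ENNReal.inv_mul_cancel h₀ h₁]
  have := eLpNorm'_le_eLpNorm'_of_exponent_le (f := u) zero_lt_one hq
    ((μ.restrict s Set.univ)⁻¹ • μ.restrict s) hu.aestronglyMeasurable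
  simpa [eLpNorm', laverage] using this

/-- Passing from boxes of side length `L` to boxes of side length between `L` and `2 * L` and of
the same duration: the latter are covered by `2 ^ n` boxes of the former kind. -/
lemma BoxReverseHolder.enlarge {n : ℕ} {u : (Fin n → ℝ) × ℝ → ℝ≥0∞} {q : ℝ} (hq : 1 ≤ q)
    {C : ℝ≥0∞} {L L' h : ℝ} (hL : 0 < L) (hh : 0 < h) (hLL' : L ≤ L') (hL'L : L' ≤ 2 * L)
    (H : BoxReverseHolder u q C L h) : BoxReverseHolder u q (2 ^ n * 2 ^ n * C) L' h := by
  intro b c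
  have hq0 : 0 < q := by linarith
  have hL' : 0 < L' := hL.trans_le hLL'
  set V := ENNReal.ofReal (L ^ n * h) with hV
  set V' := ENNReal.ofReal (L' ^ n * h) with hV'
  have hV0 : V ≠ 0 := (ENNReal.ofReal_pos.2 (mul_pos (pow_pos hL _) hh)).ne'
  have hVt : V ≠ ∞ := ENNReal.ofReal_ne_top
  have hV'0 : V' ≠ 0 := (ENNReal.ofReal_pos.2 (mul_pos (pow_pos hL' _) hh)).ne'
  have hV't : V' ≠ ∞ := ENNReal.ofReal_ne_top
  have hVV' : V ≤ V' := ENNReal.ofReal_le_ofReal (by gcongr)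
  have hV'V : V' ≤ 2 ^ n * V := by
    have : (2 : ℝ≥0∞) ^ n = ENNReal.ofReal (2 ^ n) := by
      rw [ENNReal.ofReal_pow (by norm_num)]; simp
    rw [this, hV, hV', ← ENNReal.ofReal_mul (by positivity), ← mul_assoc, ← mul_pow]
    exact ENNReal.ofReal_le_ofReal (by gcongr)
  -- the lower corners of the covering boxes
  set b' : (Fin n → Bool) → Fin n → ℝ := fun σ i => b i + if σ i then L' - L else 0 with hb'
  have hcov : halfOpenBox b L' c h ⊆ ⋃ σ, halfOpenBox (b' σ) L c h := by
    intro z hz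
    rw [mem_halfOpenBox] at hz
    refine Set.mem_iUnion.2 ⟨fun i => decide (b i + L ≤ z.1 i),
      mem_halfOpenBox.2 ⟨fun i => ?_, hz.2⟩⟩
    obtain ⟨h1, h2⟩ := hz.1 i
    simp only [hb', decide_eq_true_eq]
    split_ifs with hi <;> constructor <;> linarith
  have hsub : ∀ σ, halfOpenBox (b' σ) L (c + h) h ⊆ halfOpenBox b L' (c + h) h := by
    intro σ z hz
    rw [mem_halfOpenBox] at hz ⊢
    refine ⟨fun i => ?_, hz.2⟩
    obtain ⟨h1, h2⟩ := hz.1 i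
    simp only [hb'] at h1 h2
    split_ifs at h1 h2 <;> constructor <;> linarith
  set A := ⨍⁻ z in halfOpenBox b L' (c + h) h, u z ∂volume with hA
  have hone : ∀ σ, ∫⁻ z in halfOpenBox (b' σ) L c h, u z ^ q ≤ (C * (2 ^ n * A)) ^ q * V := by
    intro σ
    have h1 := H (b' σ) c
    have h2 : ⨍⁻ z in halfOpenBox (b' σ) L (c + h) h, u z ∂volume ≤ 2 ^ n * A := by
      rw [laverage_halfOpenBox _ _ hL, hA, laverage_halfOpenBox _ _ hL', ← hV, ← hV']
      rw [ENNReal.div_le_iff hV0 hVt]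
      calc _ ≤ ∫⁻ z in halfOpenBox b L' (c + h) h, u z := lintegral_mono_set (hsub σ)
        _ = (∫⁻ z in halfOpenBox b L' (c + h) h, u z) / V' * V' :=
          (ENNReal.div_mul_cancel hV'0 hV't).symm
        _ ≤ (∫⁻ z in halfOpenBox b L' (c + h) h, u z) / V' * (2 ^ n * V) := by gcongr
        _ = _ := by ring
    have h3 := h1.trans (mul_le_mul_right h2 C)
    rw [one_div, ENNReal.rpow_inv_le_iff hq0, laverage_halfOpenBox _ _ hL, ← hV,
      ENNReal.div_le_iff hV0 hVt] at h3
    exact h3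
  rw [one_div, ENNReal.rpow_inv_le_iff hq0, laverage_halfOpenBox _ _ hL', ← hV',
    ENNReal.div_le_iff hV'0 hV't]
  have hcard : ∑' _ : Fin n → Bool, (C * (2 ^ n * A)) ^ q * V =
      2 ^ n * ((C * (2 ^ n * A)) ^ q * V) := by
    rw [tsum_fintype, Finset.sum_const, Finset.card_univ, nsmul_eq_mul]
    simp
  have h2q : (2 : ℝ≥0∞) ^ n ≤ (2 ^ n) ^ q := by
    nth_rewrite 1 [← ENNReal.rpow_one ((2 : ℝ≥0∞) ^ n)]
    exact ENNReal.rpow_le_rpow_of_exponent_le (one_le_pow₀ one_le_two) hq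
  calc ∫⁻ z in halfOpenBox b L' c h, u z ^ q
      ≤ ∫⁻ z in ⋃ σ, halfOpenBox (b' σ) L c h, u z ^ q := lintegral_mono_set hcov
    _ ≤ ∑' σ, ∫⁻ z in halfOpenBox (b' σ) L c h, u z ^ q := lintegral_iUnion_le _ _
    _ ≤ ∑' _ : Fin n → Bool, (C * (2 ^ n * A)) ^ q * V := ENNReal.tsum_le_tsum hone
    _ = 2 ^ n * ((C * (2 ^ n * A)) ^ q * V) := hcard
    _ ≤ (2 ^ n) ^ q * ((C * (2 ^ n * A)) ^ q * V') := by gcongr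
    _ = (2 ^ n * 2 ^ n * C * A) ^ q * V' := by
      rw [← mul_assoc, ← ENNReal.mul_rpow_of_nonneg _ _ hq0.le]
      congr 2
      ring

lemma univ_pi_Ico_ae_eq_spatialCube {n : ℕ} (x : Fin n → ℝ) (L : ℝ) :
    (Set.univ.pi fun i => Set.Ico (x i - L / 2) (x i - L / 2 + L)) =ᵐ[volume]
      spatialCube x L := by
  have : spatialCube x L = Set.Icc (fun i => x i - L / 2) (fun i => x i - L / 2 + L) := by
    ext y
    simp only [spatialCube, Set.mem_ofPred_eq, Set.mem_Icc, Pi.le_def, abs_le, ← forall_and]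
    refine forall_congr' fun i => ?_
    constructor <;> rintro ⟨h1, h2⟩ <;> constructor <;> linarith
  rw [this]
  exact Measure.univ_pi_Ico_ae_eq_Icc

lemma halfOpenBox_ae_eq_lowerRect {n : ℕ} (p : ℝ) (x : Fin n → ℝ) (t L : ℝ) :
    halfOpenBox (fun i => x i - L / 2) L (t - L ^ p) (L ^ p) =ᵐ[volume] lowerRect p x t L := by
  rw [halfOpenBox, lowerRect, sub_add_cancel]
  exact Measure.set_prod_ae_eq (univ_pi_Ico_ae_eq_spatialCube x L) Ioo_ae_eq_Ico.symm

lemma halfOpenBox_ae_eq_upperRect {n : ℕ} (p : ℝ) (x : Fin n → ℝ) (t L : ℝ) :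
    halfOpenBox (fun i => x i - L / 2) L t (L ^ p) =ᵐ[volume] upperRect p x t L :=
  Measure.set_prod_ae_eq (univ_pi_Ico_ae_eq_spatialCube x L) Ioo_ae_eq_Ico.symm

/-- The parabolic reverse Hölder inequality on half-open boxes. -/
lemma ParabolicReverseHolder.boxReverseHolder {n : ℕ} {p q C : ℝ} {w g : (Fin n → ℝ) × ℝ → ℝ}
    (hw : ParabolicReverseHolder p q C w) (hq : 0 < q) (hg : ∀ z, 0 ≤ g z) (hwg : w =ᵐ[volume] g)
    {L : ℝ} (hL : 0 < L) :
    BoxReverseHolder (fun z => ENNReal.ofReal (g z)) q (ENNReal.ofReal C) L (L ^ p) := by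
  intro b c
  have h1 := halfOpenBox_ae_eq_lowerRect p (fun i => b i + L / 2) (c + L ^ p) L
  have h2 := halfOpenBox_ae_eq_upperRect p (fun i => b i + L / 2) (c + L ^ p) L
  simp only [add_sub_cancel_right] at h1 h2
  have key := hw (fun i => b i + L / 2) (c + L ^ p) L hL
  rw [← setLAverage_congr h1, ← setLAverage_congr h2] at key
  have e1 : ⨍⁻ z in halfOpenBox b L c (L ^ p), ENNReal.ofReal (w z ^ q) ∂volume =
      ⨍⁻ z in halfOpenBox b L c (L ^ p), ENNReal.ofReal (g z) ^ q ∂volume := by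
    refine laverage_congr (ae_restrict_of_ae ?_)
    filter_upwards [hwg] with z hz
    rw [hz, ENNReal.ofReal_rpow_of_nonneg (hg z) hq.le]
  have e2 : ⨍⁻ z in halfOpenBox b L (c + L ^ p) (L ^ p), ENNReal.ofReal (w z) ∂volume =
      ⨍⁻ z in halfOpenBox b L (c + L ^ p) (L ^ p), ENNReal.ofReal (g z) ∂volume := by
    refine laverage_congr (ae_restrict_of_ae ?_)
    filter_upwards [hwg] with z hz
    rw [hz]
  rwa [e1, e2] at key

/-- The reverse Hölder inequality on boxes whose side length `L` and duration `h` are comparable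
in the sense that `h ^ (1 / p) ≤ L ≤ 4 * h ^ (1 / p)`, with a constant independent of `p`. -/
lemma ParabolicReverseHolder.boxReverseHolder_of_comparable {n : ℕ} {p q C : ℝ}
    {w g : (Fin n → ℝ) × ℝ → ℝ} (hw : ParabolicReverseHolder p q C w) (hq : 1 ≤ q)
    (hg : ∀ z, 0 ≤ g z) (hwg : w =ᵐ[volume] g) {L l : ℝ} (hl : 0 < l) (hlL : l ≤ L)
    (hLl : L ≤ 4 * l) :
    BoxReverseHolder (fun z => ENNReal.ofReal (g z)) q (ENNReal.ofReal (16 ^ n * C)) L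
      (l ^ p) := by
  have hh : 0 < l ^ p := Real.rpow_pos_of_pos hl p
  have hC : (2 ^ n * 2 ^ n * (2 ^ n * 2 ^ n * ENNReal.ofReal C)) = ENNReal.ofReal (16 ^ n * C) := by
    rw [ENNReal.ofReal_mul (by positivity), ENNReal.ofReal_pow (by norm_num)]
    have : ENNReal.ofReal 16 = 2 * 2 * (2 * 2) := by
      rw [ENNReal.ofReal_ofNat]
      norm_num
    rw [this, mul_pow, mul_pow, ← mul_assoc]
  rw [← hC]
  have h0 := hw.boxReverseHolder (by linarith) hg hwg hl
  rcases le_total L (2 * l) with h | h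
  · exact (h0.enlarge hq hl hh hlL h).enlarge hq (by linarith) hh le_rfl (by linarith)
  · exact (h0.enlarge hq hl hh (by linarith) le_rfl).enlarge hq (by linarith) hh h (by linarith)

/-- The grid adapted to the parabolic geometry with exponent `p`, whose cells of generation `0`
have side length `L` and duration `L ^ p / 2`: the duration is halved in every generation, and
the side lengths are halved in about one of `p` generations. -/
noncomputable def parabolicGrid {n : ℕ} (p : ℝ) (hp : 1 ≤ p) (b : Fin n → ℝ) (a : ℝ) (L : ℝ)
    (hL : 0 < L) : SpaceTimeGrid n where
  corner := b
  start := a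
  side j := L / 2 ^ ⌊(j : ℝ) / p⌋₊
  dur j := L ^ p / 2 / 2 ^ j
  side_pos j := by positivity
  dur_pos j := by positivity
  side_succ j := by
    have hp0 : 0 < p := zero_lt_one.trans_le hp
    have h1 : ⌊(j : ℝ) / p⌋₊ ≤ ⌊((j + 1 : ℕ) : ℝ) / p⌋₊ := by gcongr; simp
    have h2 : ⌊((j + 1 : ℕ) : ℝ) / p⌋₊ ≤ ⌊(j : ℝ) / p⌋₊ + 1 := by
      rw [← Nat.floor_add_one (by positivity)]
      apply Nat.floor_le_floor
      rw [div_add_one hp0.ne']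
      push_cast
      gcongr
    rcases Nat.le_succ_iff.1 h2 with h | h
    · left
      rw [le_antisymm h h1]
    · right
      rw [h, Nat.succ_eq_add_one, pow_succ, div_div]
  dur_succ j := by rw [pow_succ, div_div _ _ (2 : ℝ)]
  side_tendsto := by
    have hp0 : 0 < p := zero_lt_one.trans_le hp
    refine Tendsto.div_atTop tendsto_const_nhds ?_
    refine (tendsto_pow_atTop_atTop_of_one_lt one_lt_two).comp ?_
    exact tendsto_nat_floor_atTop.comp (tendsto_natCast_atTop_atTop.atTop_div_const hp0)

lemma ParabolicReverseHolder.boxReverseHolder_parabolicGrid {n : ℕ} {p q C : ℝ}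
    {w g : (Fin n → ℝ) × ℝ → ℝ} (hw : ParabolicReverseHolder p q C w) (hp : 1 ≤ p) (hq : 1 ≤ q)
    (hg : ∀ z, 0 ≤ g z) (hwg : w =ᵐ[volume] g) (b : Fin n → ℝ) (a : ℝ) {L : ℝ} (hL : 0 < L)
    (j : ℕ) :
    BoxReverseHolder (fun z => ENNReal.ofReal (g z)) q (ENNReal.ofReal (16 ^ n * C))
      ((parabolicGrid p hp b a L hL).side j) ((parabolicGrid p hp b a L hL).dur j) := by
  have hp0 : 0 < p := zero_lt_one.trans_le hp
  set l : ℝ := L / 2 ^ (((j : ℝ) + 1) / p) with hl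
  have hl0 : 0 < l := by positivity
  have hd : (parabolicGrid p hp b a L hL).dur j = l ^ p := by
    rw [hl, Real.div_rpow hL.le (by positivity), ← Real.rpow_mul (by norm_num),
      div_mul_cancel₀ _ hp0.ne', ← Nat.cast_add_one, Real.rpow_natCast]
    simp only [parabolicGrid]
    rw [pow_succ', div_div]
  rw [hd]
  have hfl := Nat.floor_le (show 0 ≤ (j : ℝ) / p by positivity)
  have hfl' := Nat.lt_floor_add_one ((j : ℝ) / p)
  have h1p : 1 / p ≤ 1 := by rw [div_le_one hp0]; exact hp
  have hadd : ((j : ℝ) + 1) / p = j / p + 1 / p := add_div _ _ _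
  have h1p0 : 0 < 1 / p := by positivity
  have hside : (parabolicGrid p hp b a L hL).side j = L / 2 ^ (⌊(j : ℝ) / p⌋₊ : ℝ) := by
    rw [Real.rpow_natCast]
    rfl
  refine hw.boxReverseHolder_of_comparable hq hg hwg hl0 ?_ ?_
  · rw [hside, hl]
    gcongr
    · norm_num
    · linarith
  · rw [hside, hl, ← mul_div_assoc, div_le_div_iff₀ (by positivity) (by positivity), mul_comm 4 L,
      mul_assoc]
    gcongr
    have : (4 : ℝ) = 2 ^ (2 : ℝ) := by norm_num
    rw [this, ← Real.rpow_add (by norm_num)]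
    exact Real.rpow_le_rpow_of_exponent_le (by norm_num) (by linarith)

/-! ### The level set estimate -/

namespace SpaceTimeGrid

variable {n : ℕ} (G : SpaceTimeGrid n)

/-- The part of the spatial cell of generation `0` at the corner of the grid, during the time
interval of length `s` that starts at the starting time of the grid. -/
noncomputable def slab (s : ℝ) : Set ((Fin n → ℝ) × ℝ) :=
  halfOpenBox G.corner (G.side 0) G.start s

lemma measurableSet_slab (s : ℝ) : MeasurableSet (G.slab s) := measurableSet_halfOpenBox _ _ _ _

lemma slab_mono {s t : ℝ} (h : s ≤ t) : G.slab s ⊆ G.slab t := by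
  intro z hz
  rw [slab, mem_halfOpenBox] at hz ⊢
  exact ⟨hz.1, hz.2.1, by linarith [hz.2.2]⟩

/-- If a cell or its successor in time meets a slab, then the next cell in time lies in the slab
prolonged by three times the duration of the cell. -/
lemma cell_later_two_subset_slab {j : ℕ} {c : (Fin n → ℤ) × ℤ} {s s' : ℝ}
    (hss' : s + 3 * G.dur j ≤ s')
    (hmeet : ((G.cell j c ∪ G.cell j (later 1 c)) ∩ G.slab s).Nonempty) :
    G.cell j (later 2 c) ⊆ G.slab s' := by
  obtain ⟨y, hy, hys⟩ := hmeet
  intro z hz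
  have hd := G.dur_pos j
  have hsp : ∀ k, (G.pt j (later k c)).1 = (G.pt j c).1 := fun k => rfl
  have ht : ∀ k : ℤ, (G.pt j (later k c)).2 = (G.pt j c).2 + k * G.dur j := by
    intro k
    simp only [pt, later]
    push_cast
    ring
  rw [cell, mem_halfOpenBox, hsp, ht] at hz
  rw [slab, mem_halfOpenBox] at hys ⊢
  rw [Set.mem_union, cell, cell, mem_halfOpenBox, mem_halfOpenBox, hsp, ht] at hy
  push_cast at hy hz
  have hyc : ∀ i, (G.pt j c).1 i ≤ y.1 i ∧ y.1 i < (G.pt j c).1 i + G.side j :=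
    hy.elim (fun h => h.1) (fun h => h.1)
  have hyt : (G.pt j c).2 ≤ y.2 ∧ y.2 < (G.pt j c).2 + 2 * G.dur j := by
    rcases hy with h | h
    · exact ⟨h.2.1, by linarith [h.2.2]⟩
    · exact ⟨by linarith [h.2.1], by linarith [h.2.2]⟩
  refine ⟨?_, by linarith [hz.2.1], by linarith [hz.2.2]⟩
  -- in space, nestedness applies to points with equal times
  have hidx : G.idx j (z.1, (G.pt j c).2) = G.idx j (y.1, (G.pt j c).2) := by
    have h1 : G.idx j (z.1, (G.pt j c).2) = c := by
      rw [← mem_cell_iff, cell, mem_halfOpenBox]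
      exact ⟨hz.1, le_rfl, by simpa using hd⟩
    have h2 : G.idx j (y.1, (G.pt j c).2) = c := by
      rw [← mem_cell_iff, cell, mem_halfOpenBox]
      exact ⟨hyc, le_rfl, by simpa using hd⟩
    rw [h1, h2]
  have h0 := congrArg Prod.fst (G.idx_eq_of_le (Nat.zero_le j) hidx)
  intro i
  have hi : ⌊(z.1 i - G.corner i) / G.side 0⌋ = ⌊(y.1 i - G.corner i) / G.side 0⌋ :=
    congrFun h0 i
  have hs := G.side_pos 0
  have hy0 : ⌊(y.1 i - G.corner i) / G.side 0⌋ = 0 := by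
    rw [Int.floor_eq_zero_iff, Set.mem_Ico, le_div_iff₀ hs, div_lt_iff₀ hs]
    constructor <;> linarith [(hys.1 i).1, (hys.1 i).2]
  rw [hy0, Int.floor_eq_zero_iff, Set.mem_Ico, le_div_iff₀ hs, div_lt_iff₀ hs] at hi
  constructor <;> linarith [hi.1, hi.2]

/-- Two steps of the reverse Hölder inequality push an excess of the mass of `u ^ q` on a cell or
on its successor in time forward, to the part of the next cell where `u` is large. -/
lemma level_mul_vol_le {u : (Fin n → ℝ) × ℝ → ℝ≥0∞} (hu : Measurable u) {q : ℝ} (hq : 1 < q)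
    {C : ℝ≥0∞} (hC₁ : 1 ≤ C) (hC : C ≠ ∞) {j : ℕ}
    (H : BoxReverseHolder u q C (G.side j) (G.dur j)) {c : (Fin n → ℤ) × ℤ} {l : ℝ≥0∞}
    (hl : l ≠ ∞)
    (hbad : l ^ q * G.vol j < ∫⁻ z in G.cell j c ∪ G.cell j (later 1 c), u z ^ q) :
    l * G.vol j ≤ 4 * C ^ 2 *
      ∫⁻ z in G.cell j (later 2 c) ∩ {z | l / (4 * C ^ 2) < u z}, u z := by
  have hq0 : 0 < q := by linarith
  set V := G.vol j with hV
  have hV0 : V ≠ 0 := (G.vol_pos j).ne'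
  have hVt : V ≠ ∞ := G.vol_ne_top j
  have havg : ∀ (f : (Fin n → ℝ) × ℝ → ℝ≥0∞) d,
      ⨍⁻ z in G.cell j d, f z ∂volume = (∫⁻ z in G.cell j d, f z) / V := by
    intro f d
    rw [setLAverage_eq, G.volume_cell]
  have hRH : ∀ d, (⨍⁻ z in G.cell j d, u z ^ q ∂volume) ^ (1 / q) ≤
      C * ⨍⁻ z in G.cell j (later 1 d), u z ∂volume := by
    intro d
    have e : G.cell j (later 1 d) =
        halfOpenBox (G.pt j d).1 (G.side j) ((G.pt j d).2 + G.dur j) (G.dur j) := by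
      rw [cell]
      congr 1
      simp only [pt, later]
      push_cast
      ring
    rw [e]
    exact H _ _
  set m := ⨍⁻ z in G.cell j (later 2 c), u z ∂volume with hm
  have h1 : (⨍⁻ z in G.cell j (later 1 c), u z ^ q ∂volume) ^ (1 / q) ≤ C * m := by
    have := hRH (later 1 c)
    rwa [later_later] at this
  have h0 : (⨍⁻ z in G.cell j c, u z ^ q ∂volume) ^ (1 / q) ≤ C * (C * m) := by
    refine (hRH c).trans ?_
    gcongr
    refine le_trans ?_ h1
    exact laverage_le_laverage_rpow (by rw [G.volume_cell]; exact hV0)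
      (by rw [G.volume_cell]; exact hVt) hu hq.le
  have h1' : (⨍⁻ z in G.cell j (later 1 c), u z ^ q ∂volume) ^ (1 / q) ≤ C * (C * m) := by
    refine h1.trans ?_
    gcongr
    exact le_mul_of_one_le_left zero_le hC₁
  rw [one_div, ENNReal.rpow_inv_le_iff hq0, havg, ENNReal.div_le_iff hV0 hVt] at h0 h1'
  have h2 : l ^ q * V < (2 * (C * (C * m))) ^ q * V := by
    calc l ^ q * V < ∫⁻ z in G.cell j c ∪ G.cell j (later 1 c), u z ^ q := hbad
      _ ≤ (∫⁻ z in G.cell j c, u z ^ q) + ∫⁻ z in G.cell j (later 1 c), u z ^ q :=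
        lintegral_union_le _ _ _
      _ ≤ (C * (C * m)) ^ q * V + (C * (C * m)) ^ q * V := add_le_add h0 h1'
      _ = 2 * (C * (C * m)) ^ q * V := by ring
      _ ≤ 2 ^ q * (C * (C * m)) ^ q * V := by
        gcongr
        nth_rewrite 1 [← ENNReal.rpow_one 2]
        exact ENNReal.rpow_le_rpow_of_exponent_le one_le_two hq.le
      _ = _ := by rw [← ENNReal.mul_rpow_of_nonneg _ _ hq0.le]
  have h3 : l < 2 * C ^ 2 * m := by
    have := lt_of_mul_lt_mul_right' h2
    rw [ENNReal.rpow_lt_rpow_iff hq0] at this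
    calc l < 2 * (C * (C * m)) := this
      _ = _ := by ring
  have hK0 : 4 * C ^ 2 ≠ 0 := by
    have : C ≠ 0 := (zero_lt_one.trans_le hC₁).ne'
    positivity
  have hKt : 4 * C ^ 2 ≠ ∞ := ENNReal.mul_ne_top (by norm_num) (ENNReal.pow_ne_top hC)
  set F := G.cell j (later 2 c)
  set E := {z | l / (4 * C ^ 2) < u z} with hE
  have hEm : MeasurableSet E := measurableSet_lt measurable_const hu
  have h4 : m * V ≤ (∫⁻ z in F ∩ E, u z) + l / (4 * C ^ 2) * V := by
    rw [hm, havg, ENNReal.div_mul_cancel hV0 hVt, ← lintegral_inter_add_sdiff u F hEm]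
    gcongr
    calc ∫⁻ z in F \ E, u z ≤ ∫⁻ z in F \ E, l / (4 * C ^ 2) := by
          refine setLIntegral_mono measurable_const fun z hz => ?_
          exact not_lt.1 hz.2
      _ ≤ _ := by
        rw [setLIntegral_const, hV, ← G.volume_cell j (later 2 c)]
        gcongr
        exact Set.sdiff_subset
  -- the part of the cell where `u` is small contributes at most half of the left-hand side
  have h5 : 2 * (l * V) ≤ 4 * C ^ 2 * (∫⁻ z in F ∩ E, u z) + l * V := by
    calc 2 * (l * V) ≤ 2 * (2 * C ^ 2 * m * V) := by gcongr
      _ = 4 * C ^ 2 * (m * V) := by ring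
      _ ≤ 4 * C ^ 2 * ((∫⁻ z in F ∩ E, u z) + l / (4 * C ^ 2) * V) := by gcongr
      _ = 4 * C ^ 2 * (∫⁻ z in F ∩ E, u z) + (4 * C ^ 2) * (l / (4 * C ^ 2)) * V := by ring
      _ = _ := by rw [ENNReal.mul_div_cancel hK0 hKt]
  rw [two_mul] at h5
  exact (ENNReal.add_le_add_iff_right (ENNReal.mul_ne_top hl hVt)).1 h5

/-- The level set estimate at the heart of the self-improvement: above the level `l`, the mass of
`u ^ q` on a slab is controlled by the mass of `u` on a longer slab, above a comparable level.
The level has to be so high that no cell of generation at most `J` exceeds it; the stopping cells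
are then so short that the region on the right contains all cells two steps after them. -/
lemma lintegral_superlevel_slab_le {u : (Fin n → ℝ) × ℝ → ℝ≥0∞} (hu : Measurable u) {q : ℝ}
    (hq : 1 < q) {C : ℝ≥0∞} (hC₁ : 1 ≤ C) (hC : C ≠ ∞)
    (H : ∀ j, BoxReverseHolder u q C (G.side j) (G.dur j)) {s s' : ℝ} {J : ℕ}
    (hss' : s + 3 * G.dur (J + 1) ≤ s') {l : ℝ≥0∞} (hl₀ : l ≠ 0) (hl : l ≠ ∞)
    (hroot : ∀ j ≤ J, ∫⁻ z in G.slab s, u z ^ q ≤ l ^ q * G.vol j) :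
    ∫⁻ z in G.slab s ∩ {z | l < u z}, u z ^ q ≤ 2 ^ (n + 1) * (4 * C ^ 2) * l ^ (q - 1) *
      ∫⁻ z in G.slab s' ∩ {z | l / (4 * C ^ 2) < u z}, u z := by
  have hq0 : 0 < q := by linarith
  set E := {z | l / (4 * C ^ 2) < u z} with hE
  have hEm : MeasurableSet E := measurableSet_lt measurable_const hu
  have hlq0 : l ^ q ≠ 0 := by simp [ENNReal.rpow_eq_zero_iff, hl₀, hl]
  have hlqt : l ^ q ≠ ∞ := ENNReal.rpow_ne_top_of_nonneg hq0.le hl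
  have hvint : ∀ A, MeasurableSet A → ∫⁻ z in A, (G.slab s).indicator (fun z => u z ^ q) z =
      ∫⁻ z in G.slab s ∩ A, u z ^ q := by
    intro A hA
    rw [lintegral_indicator (G.measurableSet_slab s),
      Measure.restrict_restrict (G.measurableSet_slab s)]
  have key := G.lintegral_superlevel_le (v := (G.slab s).indicator fun z => u z ^ q)
    (u := fun z => 4 * C ^ 2 * l ^ (q - 1) * (G.slab s' ∩ E).indicator u z)
    ((hu.pow_const q).indicator (G.measurableSet_slab s)) hlq0 hlqt
    (by
      rw [lintegral_indicator (G.measurableSet_slab s)]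
      exact hroot 0 (Nat.zero_le _))
    (by
      intro j c hbad
      have hPm := (G.measurableSet_cell j c).union (G.measurableSet_cell j (later 1 c))
      rw [hvint _ hPm] at hbad
      have hJj : J + 1 ≤ j := by
        by_contra! hlt
        exact absurd (hbad.trans_le (lintegral_mono_set Set.inter_subset_left))
          (not_lt.2 (hroot j (by omega)))
      have hmeet : ((G.cell j c ∪ G.cell j (later 1 c)) ∩ G.slab s).Nonempty := by
        rw [Set.nonempty_iff_ne_empty, Set.inter_comm]
        intro hem
        rw [hem] at hbad
        simp at hbad
      have hsub := G.cell_later_two_subset_slab (s' := s')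
        (by linarith [G.dur_le_of_le hJj]) hmeet
      have := G.level_mul_vol_le hu hq hC₁ hC (H j) (c := c) hl
        (hbad.trans_le (lintegral_mono_set Set.inter_subset_right))
      rw [lintegral_const_mul _ (hu.indicator ((G.measurableSet_slab s').inter hEm)),
        lintegral_indicator ((G.measurableSet_slab s').inter hEm),
        Measure.restrict_restrict ((G.measurableSet_slab s').inter hEm)]
      have hset : G.slab s' ∩ E ∩ G.cell j (later 2 c) = G.cell j (later 2 c) ∩ E := by
        ext z
        constructor
        · rintro ⟨⟨-, h2⟩, h3⟩
          exact ⟨h3, h2⟩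
        · rintro ⟨h3, h2⟩
          exact ⟨⟨hsub h3, h2⟩, h3⟩
      rw [hset]
      calc l ^ q * G.vol j = l ^ (q - 1) * (l * G.vol j) := by
            rw [← mul_assoc]
            congr 1
            nth_rewrite 3 [← ENNReal.rpow_one l]
            rw [← ENNReal.rpow_add _ _ hl₀ hl, sub_add_cancel]
        _ ≤ l ^ (q - 1) * (4 * C ^ 2 * ∫⁻ z in G.cell j (later 2 c) ∩ E, u z) := by gcongr
        _ = _ := by ring)
  have hleft : G.slab s ∩ {z | l < u z} ⊆
      G.slab s ∩ {z | l ^ q < (G.slab s).indicator (fun z => u z ^ q) z} := by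
    rintro z ⟨h1, h2⟩
    refine ⟨h1, ?_⟩
    simpa [Set.indicator_of_mem h1] using ENNReal.rpow_lt_rpow h2 hq0
  calc _ ≤ _ := lintegral_mono_set hleft
    _ = _ := (hvint _ (measurableSet_lt measurable_const
      ((hu.pow_const q).indicator (G.measurableSet_slab s)))).symm
    _ ≤ _ := key
    _ = _ := by
      rw [lintegral_const_mul _ (hu.indicator ((G.measurableSet_slab s').inter hEm)),
        lintegral_indicator ((G.measurableSet_slab s').inter hEm)]
      ring

end SpaceTimeGrid

/-! ### Integration over the levels and absorption -/

/-- Integration of the level set estimate in `l` against `l ^ (ε - 1)`. The truncation of the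
weight `g ^ ε` at height `N` keeps the integrals finite, so that the last term, whose factor is
small for small `ε`, can be absorbed. -/
lemma lintegral_min_rpow_mul_le {α : Type*} [MeasurableSpace α] {μ ν : Measure α} {g : α → ℝ}
    (hg : Measurable g) (hg₀ : ∀ z, 0 ≤ g z) {q ε κ l₀ N : ℝ} (hq : 1 < q) (hε : 0 < ε)
    (hκ : 1 ≤ κ) (hl₀ : 0 ≤ l₀) (hN : 0 ≤ N) {K : ℝ≥0∞}
    (H : ∀ l, l₀ ≤ l → 0 < l → ∫⁻ z in {z | l < g z}, ENNReal.ofReal (g z) ^ q ∂μ ≤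
      K * ENNReal.ofReal l ^ (q - 1) * ∫⁻ z in {z | l / κ < g z}, ENNReal.ofReal (g z) ∂ν) :
    ∫⁻ z, ENNReal.ofReal (min (g z) N ^ ε) * ENNReal.ofReal (g z) ^ q ∂μ ≤
      ENNReal.ofReal (l₀ ^ ε) * ∫⁻ z, ENNReal.ofReal (g z) ^ q ∂μ +
      ENNReal.ofReal (ε / (q - 1) * κ ^ (q - 1 + ε)) * K *
        ∫⁻ z, ENNReal.ofReal (min (g z) N ^ ε) * ENNReal.ofReal (g z) ^ q ∂ν := by
  have hκ0 : 0 < κ := by linarith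
  have hr : 0 < q - 1 + ε := by linarith
  have hu : Measurable fun z => ENNReal.ofReal (g z) := hg.ennreal_ofReal
  have huq : Measurable fun z => ENNReal.ofReal (g z) ^ q := hu.pow_const q
  have hmin : Measurable fun z => min (g z) N := hg.min measurable_const
  have hmin0 : ∀ z, 0 ≤ min (g z) N := fun z => le_min (hg₀ z) hN
  have hmin' : Measurable fun z => min (g z * κ) N := (hg.mul_const κ).min measurable_const
  have hmin0' : ∀ z, 0 ≤ min (g z * κ) N := fun z => le_min (mul_nonneg (hg₀ z) hκ0.le) hN
  set m₁ := μ.withDensity fun z => ENNReal.ofReal (g z) ^ q with hm₁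
  set m₂ := ν.withDensity fun z => ENNReal.ofReal (g z) with hm₂
  have hm₁a : ∀ f : α → ℝ≥0∞, Measurable f →
      ∫⁻ z, f z ∂m₁ = ∫⁻ z, f z * ENNReal.ofReal (g z) ^ q ∂μ := by
    intro f hf
    rw [hm₁, lintegral_withDensity_eq_lintegral_mul _ huq hf]
    exact lintegral_congr fun z => mul_comm _ _
  have hm₂a : ∀ f : α → ℝ≥0∞, Measurable f →
      ∫⁻ z, f z ∂m₂ = ∫⁻ z, f z * ENNReal.ofReal (g z) ∂ν := by
    intro f hf
    rw [hm₂, lintegral_withDensity_eq_lintegral_mul _ hu hf]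
    exact lintegral_congr fun z => mul_comm _ _
  have cake₁ := lintegral_rpow_eq_lintegral_meas_lt_mul m₁ (Eventually.of_forall hmin0)
    hmin.aemeasurable hε
  have cake₀ := lintegral_rpow_eq_lintegral_meas_lt_mul m₁ (f := fun _ => l₀)
    (Eventually.of_forall fun _ => hl₀) aemeasurable_const hε
  have cake₂ := lintegral_rpow_eq_lintegral_meas_lt_mul m₂ (Eventually.of_forall hmin0')
    hmin'.aemeasurable hr
  -- the level set estimate is used above `l₀`, the trivial bound below `l₀`
  have hlevel : ∀ t ∈ Set.Ioi (0 : ℝ), m₁ {z | t < min (g z) N} * ENNReal.ofReal (t ^ (ε - 1)) ≤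
      m₁ {_z | t < l₀} * ENNReal.ofReal (t ^ (ε - 1)) +
      K * (m₂ {z | t < min (g z * κ) N} * ENNReal.ofReal (t ^ (q - 1 + ε - 1))) := by
    intro t ht
    have ht0 : (0 : ℝ) < t := ht
    rcases lt_or_ge t l₀ with h | h
    · refine le_add_right ?_
      gcongr ?_ * _
      exact measure_mono fun _ _ => h
    · refine le_add_left ?_
      rcases lt_or_ge t N with hN' | hN'
      · have e1 : {z | t < min (g z) N} = {z | t < g z} := by
          ext z
          simp [hN']
        have e2 : {z | t < min (g z * κ) N} = {z | t / κ < g z} := by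
          ext z
          simp [hN', div_lt_iff₀ hκ0]
        have e3 : ENNReal.ofReal (t ^ (q - 1 + ε - 1)) =
            ENNReal.ofReal t ^ (q - 1) * ENNReal.ofReal (t ^ (ε - 1)) := by
          rw [ENNReal.ofReal_rpow_of_pos ht0, ← ENNReal.ofReal_mul (by positivity),
            ← Real.rpow_add ht0]
          ring_nf
        rw [e1, e2, e3, hm₁, hm₂, withDensity_apply _ (measurableSet_lt measurable_const hg),
          withDensity_apply _ (measurableSet_lt measurable_const hg)]
        calc _ ≤ (K * ENNReal.ofReal t ^ (q - 1) *
              ∫⁻ z in {z | t / κ < g z}, ENNReal.ofReal (g z) ∂ν) *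
                ENNReal.ofReal (t ^ (ε - 1)) := by
              gcongr
              exact H t h ht0
          _ = _ := by ring
      · have e1 : {z | t < min (g z) N} = ∅ := by
          ext z
          simp [hN']
        rw [e1]
        simp
  have hpt : ∀ z, ENNReal.ofReal (min (g z * κ) N ^ (q - 1 + ε)) * ENNReal.ofReal (g z) ≤
      ENNReal.ofReal (κ ^ (q - 1 + ε)) *
        (ENNReal.ofReal (min (g z) N ^ ε) * ENNReal.ofReal (g z) ^ q) := by
    intro z
    have hz := hg₀ z
    have hz' := hmin0 z
    rw [ENNReal.ofReal_rpow_of_nonneg hz (by linarith),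
      ← ENNReal.ofReal_mul (Real.rpow_nonneg (hmin0' z) _),
      ← ENNReal.ofReal_mul (Real.rpow_nonneg hz' _), ← ENNReal.ofReal_mul (by positivity)]
    apply ENNReal.ofReal_le_ofReal
    have h1 : min (g z * κ) N ≤ κ * min (g z) N := by
      rw [mul_min_of_nonneg _ _ hκ0.le, mul_comm]
      exact min_le_min_left _ (le_mul_of_one_le_left hN hκ)
    have h2 : g z ^ q = g z ^ (q - 1) * g z := by
      rcases hz.eq_or_lt with h | h
      · rw [← h, Real.zero_rpow (by linarith), mul_zero]
      · nth_rewrite 3 [← Real.rpow_one (g z)]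
        rw [← Real.rpow_add h, sub_add_cancel]
    calc min (g z * κ) N ^ (q - 1 + ε) * g z
        ≤ (κ * min (g z) N) ^ (q - 1 + ε) * g z := by
          gcongr
      _ = κ ^ (q - 1 + ε) * (min (g z) N ^ (q - 1) * min (g z) N ^ ε * g z) := by
          rw [Real.mul_rpow hκ0.le hz', Real.rpow_add_of_nonneg hz' (by linarith) hε.le]
          ring
      _ ≤ κ ^ (q - 1 + ε) * (g z ^ (q - 1) * min (g z) N ^ ε * g z) := by
          gcongr κ ^ (q - 1 + ε) * (?_ * _ * _)
          exact Real.rpow_le_rpow hz' (min_le_left _ _) (by linarith)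
      _ = _ := by rw [h2]; ring
  have hmeas : ∀ (m : Measure α) (f : α → ℝ) (r : ℝ),
      Measurable fun t : ℝ => m {z | t < f z} * ENNReal.ofReal (t ^ r) := by
    intro m f r
    refine Measurable.mul ?_ (measurable_id.pow_const r).ennreal_ofReal
    exact Antitone.measurable fun s t hst => measure_mono fun z (hz : t < f z) => hst.trans_lt hz
  rw [← hm₁a _ (hmin.pow_const ε).ennreal_ofReal, cake₁]
  have hI₂ : ∫⁻ t in Set.Ioi (0 : ℝ),
      m₂ {z | t < min (g z * κ) N} * ENNReal.ofReal (t ^ (q - 1 + ε - 1)) ≤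
      (ENNReal.ofReal (q - 1 + ε))⁻¹ * (ENNReal.ofReal (κ ^ (q - 1 + ε)) *
        ∫⁻ z, ENNReal.ofReal (min (g z) N ^ ε) * ENNReal.ofReal (g z) ^ q ∂ν) := by
    have hr0 : ENNReal.ofReal (q - 1 + ε) ≠ 0 := (ENNReal.ofReal_pos.2 hr).ne'
    rw [← lintegral_const_mul (f := fun z => ENNReal.ofReal (min (g z) N ^ ε) *
        ENNReal.ofReal (g z) ^ q) _ ((hmin.pow_const ε).ennreal_ofReal.mul huq),
      mul_comm _⁻¹, ← div_eq_mul_inv,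
      ENNReal.le_div_iff_mul_le (Or.inl hr0) (Or.inl ENNReal.ofReal_ne_top), mul_comm, ← cake₂,
      hm₂a _ (hmin'.pow_const _).ennreal_ofReal]
    exact lintegral_mono hpt
  have hcoef : ENNReal.ofReal ε * (ENNReal.ofReal (q - 1 + ε))⁻¹ *
      ENNReal.ofReal (κ ^ (q - 1 + ε)) ≤
      ENNReal.ofReal (ε / (q - 1) * κ ^ (q - 1 + ε)) := by
    rw [← ENNReal.ofReal_inv_of_pos hr, ← ENNReal.ofReal_mul hε.le,
      ← ENNReal.ofReal_mul (by positivity), ← div_eq_mul_inv]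
    apply ENNReal.ofReal_le_ofReal
    gcongr
    linarith
  calc ENNReal.ofReal ε * ∫⁻ t in Set.Ioi (0 : ℝ),
        m₁ {z | t < min (g z) N} * ENNReal.ofReal (t ^ (ε - 1))
      ≤ ENNReal.ofReal ε * ∫⁻ t in Set.Ioi (0 : ℝ),
        (m₁ {_z | t < l₀} * ENNReal.ofReal (t ^ (ε - 1)) +
          K * (m₂ {z | t < min (g z * κ) N} * ENNReal.ofReal (t ^ (q - 1 + ε - 1)))) := by
        gcongr 1
        exact setLIntegral_mono' measurableSet_Ioi hlevel
    _ = ∫⁻ _, ENNReal.ofReal (l₀ ^ ε) ∂m₁ + ENNReal.ofReal ε * (K * ∫⁻ t in Set.Ioi (0 : ℝ),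
          m₂ {z | t < min (g z * κ) N} * ENNReal.ofReal (t ^ (q - 1 + ε - 1))) := by
        rw [lintegral_add_left (hmeas m₁ (fun _ => l₀) (ε - 1)), mul_add, ← cake₀,
          lintegral_const_mul _ (hmeas m₂ (fun z => min (g z * κ) N) _)]
    _ ≤ ENNReal.ofReal (l₀ ^ ε) * ∫⁻ z, ENNReal.ofReal (g z) ^ q ∂μ + ENNReal.ofReal ε * (K *
          ((ENNReal.ofReal (q - 1 + ε))⁻¹ * (ENNReal.ofReal (κ ^ (q - 1 + ε)) *
        ∫⁻ z, ENNReal.ofReal (min (g z) N ^ ε) * ENNReal.ofReal (g z) ^ q ∂ν))) := by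
        rw [hm₁a _ measurable_const, lintegral_const_mul _ huq]
        gcongr
    _ = ENNReal.ofReal (l₀ ^ ε) * ∫⁻ z, ENNReal.ofReal (g z) ^ q ∂μ +
        ENNReal.ofReal ε * (ENNReal.ofReal (q - 1 + ε))⁻¹ * ENNReal.ofReal (κ ^ (q - 1 + ε)) * K *
        ∫⁻ z, ENNReal.ofReal (min (g z) N ^ ε) * ENNReal.ofReal (g z) ^ q ∂ν := by ring
    _ ≤ _ := by gcongr

/-- An absorption argument for bounded sequences: the geometric growth of the error terms is
beaten by the factor `θ` of the next term of the sequence. -/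
lemma le_two_mul_of_le_add_mul_succ {Φ : ℕ → ℝ≥0∞} {A b θ B : ℝ≥0∞} (hB : B ≠ ∞)
    (hΦB : ∀ i, Φ i ≤ B) (hb : 1 ≤ b) (hθ : θ * b ≤ 1 / 2)
    (hΦ : ∀ i, Φ i ≤ A * b ^ i + θ * Φ (i + 1)) : Φ 0 ≤ 2 * A := by
  have hθ' : θ ≤ 1 / 2 := (le_mul_of_one_le_right' hb).trans hθ
  have h2 : (2 : ℝ≥0∞) * (1 / 2) = 1 := by
    rw [one_div, ENNReal.mul_inv_cancel two_ne_zero ENNReal.ofNat_ne_top]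
  have key : ∀ N i, Φ i ≤ 2 * A * b ^ i + (1 / 2) ^ N * B := by
    intro N
    induction N with
    | zero =>
      intro i
      rw [pow_zero, one_mul]
      exact (hΦB i).trans le_add_self
    | succ N ih =>
      intro i
      calc Φ i ≤ A * b ^ i + θ * Φ (i + 1) := hΦ i
        _ ≤ A * b ^ i + θ * (2 * A * b ^ (i + 1) + (1 / 2) ^ N * B) := by
          gcongr
          exact ih (i + 1)
        _ = A * b ^ i + (2 * (θ * b) * (A * b ^ i) + θ * ((1 / 2) ^ N * B)) := by ring
        _ ≤ A * b ^ i + (2 * (1 / 2) * (A * b ^ i) + 1 / 2 * ((1 / 2) ^ N * B)) := by gcongr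
        _ = _ := by
          rw [h2]
          ring
  have hlim : Tendsto (fun N : ℕ => 2 * A + (1 / 2 : ℝ≥0∞) ^ N * B) atTop (𝓝 (2 * A + 0 * B)) := by
    refine tendsto_const_nhds.add (ENNReal.Tendsto.mul_const ?_ (Or.inr hB))
    exact ENNReal.tendsto_pow_atTop_nhds_zero_of_lt_one (by simp)
  simp only [zero_mul, add_zero] at hlim
  exact ge_of_tendsto' hlim fun N => by simpa using key N 0

/-- Removal of the truncation in the weight `g ^ ε`, by monotone convergence. -/
lemma lintegral_rpow_add_le_of_forall_min {α : Type*} [MeasurableSpace α] {μ : Measure α}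
    {g : α → ℝ} (hg : Measurable g) (hg₀ : ∀ z, 0 ≤ g z) {q ε : ℝ} (hq : 0 < q) (hε : 0 < ε)
    {B : ℝ≥0∞} (H : ∀ N : ℕ,
      ∫⁻ z, ENNReal.ofReal (min (g z) N ^ ε) * ENNReal.ofReal (g z) ^ q ∂μ ≤ B) :
    ∫⁻ z, ENNReal.ofReal (g z) ^ (q + ε) ∂μ ≤ B := by
  refine le_of_tendsto' (lintegral_tendsto_of_tendsto_of_monotone (fun N : ℕ => ?_) ?_ ?_) H
  · have hmin : Measurable fun z => min (g z) (N : ℝ) := hg.min measurable_const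
    exact ((hmin.pow_const ε).ennreal_ofReal.mul (hg.ennreal_ofReal.pow_const q)).aemeasurable
  · refine Eventually.of_forall fun z M N hMN => ?_
    have hz := hg₀ z
    have : (0 : ℝ) ≤ M := Nat.cast_nonneg _
    have : 0 ≤ min (g z) (M : ℝ) := le_min hz this
    simp only
    gcongr
  · refine Eventually.of_forall fun z => tendsto_const_nhds.congr' ?_
    filter_upwards [eventually_ge_atTop ⌈g z⌉₊] with N hN
    rw [min_eq_left ((Nat.le_ceil _).trans (by exact_mod_cast hN)),
      ← ENNReal.ofReal_rpow_of_nonneg (hg₀ z) hε.le, mul_comm,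
      ENNReal.rpow_add_of_nonneg _ _ hq.le hε.le]

namespace SpaceTimeGrid

variable {n : ℕ} (G : SpaceTimeGrid n)

/-- The local form of the higher integrability. The slabs are prolonged by
`G.dur 0 / 2 ^ (i + 1)` in the `i`-th step of the iteration, which allows stopping cells of
generation at least `i + 3` only. -/
lemma lintegral_slab_rpow_add_le {g : (Fin n → ℝ) × ℝ → ℝ} (hg : Measurable g)
    (hg₀ : ∀ z, 0 ≤ g z) {q c ε : ℝ} (hq : 1 < q) (hc : 1 ≤ c)
    (H : ∀ j, BoxReverseHolder (fun z => ENNReal.ofReal (g z)) q (ENNReal.ofReal c)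
      (G.side j) (G.dur j))
    (hε₀ : 0 < ε) (hε₁ : ε ≤ 1)
    (hε : ε / (q - 1) * (4 * c ^ 2) ^ (q + 1) * 2 ^ (n + 1) * 2 ^ (n + 1) ≤ 1 / 2) {M : ℝ}
    (hM₀ : 0 ≤ M)
    (hM : ∫⁻ z in G.slab (2 * G.dur 0), ENNReal.ofReal (g z) ^ q ≤ ENNReal.ofReal M * G.vol 0) :
    ∫⁻ z in G.slab (G.dur 0), ENNReal.ofReal (g z) ^ (q + ε) ≤
      ENNReal.ofReal (2 * 4 ^ (n + 1) * M ^ (1 + ε / q)) * G.vol 0 := by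
  have hq0 : 0 < q := by linarith
  have hd := G.dur_pos 0
  set κ : ℝ := 4 * c ^ 2 with hκ
  have hκ1 : 1 ≤ κ := by nlinarith
  have hκ0 : 0 < κ := by linarith
  have hCκ : 4 * ENNReal.ofReal c ^ 2 = ENNReal.ofReal κ := by
    rw [hκ, ENNReal.ofReal_mul (by norm_num), ENNReal.ofReal_pow (by linarith),
      ENNReal.ofReal_ofNat]
  set β : ℝ := 2 ^ (n + 1) with hβ
  have hβ1 : 1 ≤ β := one_le_pow₀ one_le_two
  have hβE : ENNReal.ofReal β = 2 ^ (n + 1) := by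
    rw [hβ, ENNReal.ofReal_pow (by norm_num), ENNReal.ofReal_ofNat]
  set s : ℕ → ℝ := fun i => 2 * G.dur 0 - G.dur 0 / 2 ^ i with hs
  have hs2 : ∀ i, s i ≤ 2 * G.dur 0 := fun i => by
    have : 0 < G.dur 0 / 2 ^ i := by positivity
    simp only [hs]
    linarith
  have hsstep : ∀ i, s i + 3 * G.dur (i + 2 + 1) ≤ s (i + 1) := by
    intro i
    have : 0 < G.dur 0 / 2 ^ i := by positivity
    have h1 : G.dur 0 / 2 ^ (i + 1) = G.dur 0 / 2 ^ i / 2 := by rw [pow_succ, div_div]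
    have h2 : G.dur 0 / 2 ^ (i + 2 + 1) = G.dur 0 / 2 ^ i / 8 := by
      rw [div_div]
      congr 1
      ring
    rw [G.dur_eq (i + 2 + 1)]
    simp only [hs]
    rw [h1, h2]
    linarith
  set l₀ : ℕ → ℝ := fun i => (M * β ^ (i + 2)) ^ (1 / q) with hl₀
  have hl₀0 : ∀ i, 0 ≤ l₀ i := fun i => by positivity
  have hl₀q : ∀ i, l₀ i ^ q = M * β ^ (i + 2) := by
    intro i
    simp only [hl₀]
    rw [← Real.rpow_mul (by positivity), one_div, inv_mul_cancel₀ hq0.ne', Real.rpow_one]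
  have hMs : ∀ i, ∫⁻ z in G.slab (s i), ENNReal.ofReal (g z) ^ q ≤ ENNReal.ofReal M * G.vol 0 :=
    fun i => (lintegral_mono_set (G.slab_mono (hs2 i))).trans hM
  refine lintegral_rpow_add_le_of_forall_min hg hg₀ hq0 hε₀ fun N => ?_
  have hN : (0 : ℝ) ≤ N := Nat.cast_nonneg N
  set Φ : ℕ → ℝ≥0∞ := fun i => ∫⁻ z in G.slab (s i),
    ENNReal.ofReal (min (g z) N ^ ε) * ENNReal.ofReal (g z) ^ q with hΦ
  have hΦB : ∀ i, Φ i ≤ ENNReal.ofReal ((N : ℝ) ^ ε) * (ENNReal.ofReal M * G.vol 0) := by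
    intro i
    calc Φ i ≤ ∫⁻ z in G.slab (s i), ENNReal.ofReal ((N : ℝ) ^ ε) * ENNReal.ofReal (g z) ^ q := by
          refine lintegral_mono fun z => ?_
          have : 0 ≤ min (g z) (N : ℝ) := le_min (hg₀ z) hN
          simp only
          gcongr
          exact min_le_right _ _
      _ = ENNReal.ofReal ((N : ℝ) ^ ε) * ∫⁻ z in G.slab (s i), ENNReal.ofReal (g z) ^ q :=
          lintegral_const_mul _ (hg.ennreal_ofReal.pow_const q)
      _ ≤ _ := by
          gcongr
          exact hMs i
  have hstep : ∀ i, Φ i ≤ (ENNReal.ofReal (4 ^ (n + 1) * M ^ (1 + ε / q)) * G.vol 0) *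
      (2 ^ (n + 1)) ^ i + ENNReal.ofReal (ε / (q - 1) * κ ^ (q + 1) * β) * Φ (i + 1) := by
    intro i
    have hcake := lintegral_min_rpow_mul_le (μ := volume.restrict (G.slab (s i)))
      (ν := volume.restrict (G.slab (s (i + 1)))) hg hg₀ hq hε₀ hκ1 (hl₀0 i) hN
      (K := ENNReal.ofReal (β * κ)) (by
        intro l hl hl0
        have hlevel := G.lintegral_superlevel_slab_le hg.ennreal_ofReal hq
          (ENNReal.one_le_ofReal.2 hc) ENNReal.ofReal_ne_top H (hsstep i)
          (ENNReal.ofReal_pos.2 hl0).ne' ENNReal.ofReal_ne_top (l := ENNReal.ofReal l) (by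
            intro j hj
            calc _ ≤ ENNReal.ofReal M * G.vol 0 := hMs i
              _ ≤ ENNReal.ofReal M * ((2 ^ (n + 1)) ^ j * G.vol j) := by
                gcongr
                exact G.vol_zero_le j
              _ ≤ ENNReal.ofReal M * ((2 ^ (n + 1)) ^ (i + 2) * G.vol j) := by
                gcongr
                exact one_le_pow₀ one_le_two
              _ = ENNReal.ofReal (l₀ i) ^ q * G.vol j := by
                rw [ENNReal.ofReal_rpow_of_nonneg (hl₀0 i) hq0.le, hl₀q, ENNReal.ofReal_mul hM₀,
                  ENNReal.ofReal_pow (by positivity), hβE, mul_assoc]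
              _ ≤ _ := by gcongr)
        have e1 : {z | ENNReal.ofReal l < ENNReal.ofReal (g z)} = {z | l < g z} := by
          ext z
          exact ENNReal.ofReal_lt_ofReal_iff_of_nonneg hl0.le
        have e2 : {z | ENNReal.ofReal l / ENNReal.ofReal κ < ENNReal.ofReal (g z)} =
            {z | l / κ < g z} := by
          ext z
          rw [← ENNReal.ofReal_div_of_pos hκ0]
          exact ENNReal.ofReal_lt_ofReal_iff_of_nonneg (by positivity)
        have hm : ∀ t : ℝ, MeasurableSet {z | t < g z} :=
          fun t => measurableSet_lt measurable_const hg
        rw [hCκ, e1, e2] at hlevel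
        rw [Measure.restrict_restrict (hm _), Measure.restrict_restrict (hm _), Set.inter_comm,
          Set.inter_comm {z | l / κ < g z}, ENNReal.ofReal_mul (by positivity), hβE]
        exact hlevel)
    refine hcake.trans (add_le_add ?_ ?_)
    · have hlε : l₀ i ^ ε ≤ M ^ (ε / q) * β ^ (i + 2) := by
        simp only [hl₀]
        rw [← Real.rpow_mul (by positivity), Real.mul_rpow hM₀ (by positivity),
          one_div_mul_eq_div]
        gcongr
        refine (Real.rpow_le_rpow_of_exponent_le (one_le_pow₀ hβ1) ?_).trans_eq (Real.rpow_one _)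
        rw [div_le_one hq0]
        linarith
      have hreal : M ^ (ε / q) * β ^ (i + 2) * M = 4 ^ (n + 1) * M ^ (1 + ε / q) * β ^ i := by
        have h1 : M ^ (1 + ε / q) = M * M ^ (ε / q) := by
          rw [Real.rpow_add_of_nonneg hM₀ zero_le_one (by positivity), Real.rpow_one]
        have h2 : (4 : ℝ) ^ (n + 1) = β ^ 2 := by
          rw [hβ, ← pow_mul, mul_comm, pow_mul]
          norm_num
        rw [h1, h2, pow_add]
        ring
      calc ENNReal.ofReal (l₀ i ^ ε) * ∫⁻ z in G.slab (s i), ENNReal.ofReal (g z) ^ q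
          ≤ ENNReal.ofReal (M ^ (ε / q) * β ^ (i + 2)) * (ENNReal.ofReal M * G.vol 0) := by
            gcongr
            exact hMs i
        _ = ENNReal.ofReal (4 ^ (n + 1) * M ^ (1 + ε / q) * β ^ i) * G.vol 0 := by
            rw [← mul_assoc, ← ENNReal.ofReal_mul (by positivity), hreal]
        _ = _ := by
            rw [ENNReal.ofReal_mul (by positivity), ENNReal.ofReal_pow (by positivity), hβE]
            ring
    · have hq1 : 0 < q - 1 := by linarith
      gcongr ?_ * ?_
      · rw [← ENNReal.ofReal_mul (by positivity)]
        apply ENNReal.ofReal_le_ofReal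
        calc ε / (q - 1) * κ ^ (q - 1 + ε) * (β * κ)
            = ε / (q - 1) * (κ ^ (q - 1 + ε) * κ) * β := by ring
          _ = ε / (q - 1) * κ ^ (q + ε) * β := by
            rw [← Real.rpow_add_one hκ0.ne']
            ring_nf
          _ ≤ _ := by gcongr
      · exact le_rfl
  have hθb : ENNReal.ofReal (ε / (q - 1) * κ ^ (q + 1) * β) * 2 ^ (n + 1) ≤ 1 / 2 := by
    have hq1 : 0 < q - 1 := by linarith
    rw [← hβE, ← ENNReal.ofReal_mul (by positivity)]
    refine (ENNReal.ofReal_le_ofReal hε).trans_eq ?_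
    rw [ENNReal.ofReal_div_of_pos two_pos]
    simp
  have := le_two_mul_of_le_add_mul_succ
    (ENNReal.mul_ne_top ENNReal.ofReal_ne_top (ENNReal.mul_ne_top ENNReal.ofReal_ne_top
      (G.vol_ne_top 0))) hΦB (one_le_pow₀ one_le_two) hθb hstep
  have hs0 : s 0 = G.dur 0 := by
    simp only [hs]
    ring
  simp only [hΦ, hs0] at this
  refine this.trans_eq ?_
  rw [← mul_assoc, mul_assoc (2 : ℝ), ENNReal.ofReal_mul two_pos.le, ENNReal.ofReal_ofNat]

end SpaceTimeGrid

/-! ### The estimate on parabolic rectangles -/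

lemma BoxReverseHolder.mono {n : ℕ} {u : (Fin n → ℝ) × ℝ → ℝ≥0∞} {q : ℝ} {C C' : ℝ≥0∞} {L h : ℝ}
    (H : BoxReverseHolder u q C L h) (hC : C ≤ C') : BoxReverseHolder u q C' L h := by
  intro b c
  refine (H b c).trans ?_
  gcongr

/-- Iterating the reverse Hölder inequality over three consecutive boxes. -/
lemma BoxReverseHolder.laverage_chain {n : ℕ} {u : (Fin n → ℝ) × ℝ → ℝ≥0∞} (hu : Measurable u)
    {q : ℝ} (hq : 1 ≤ q) {C : ℝ≥0∞} {L h : ℝ} (hL : 0 < L) (hh : 0 < h)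
    (H : BoxReverseHolder u q C L h) (hC : 1 ≤ C) (b : Fin n → ℝ) (a : ℝ) {k : ℕ} (hk : k ≤ 2) :
    ⨍⁻ z in halfOpenBox b L (a + k * h) h, u z ^ q ∂volume ≤
      (C ^ 3 * ⨍⁻ z in halfOpenBox b L (a + 3 * h) h, u z ∂volume) ^ q := by
  have hq0 : 0 < q := by linarith
  set m := ⨍⁻ z in halfOpenBox b L (a + 3 * h) h, u z ∂volume with hm
  have hJ : ∀ c, ⨍⁻ z in halfOpenBox b L c h, u z ∂volume ≤
      (⨍⁻ z in halfOpenBox b L c h, u z ^ q ∂volume) ^ (1 / q) := fun c =>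
    laverage_le_laverage_rpow (volume_halfOpenBox_ne_zero b hL c hh)
      (volume_halfOpenBox_ne_top b hL c) hu hq
  have h2 : (⨍⁻ z in halfOpenBox b L (a + 2 * h) h, u z ^ q ∂volume) ^ (1 / q) ≤ C * m := by
    have := H b (a + 2 * h)
    rwa [show a + 2 * h + h = a + 3 * h by ring] at this
  have h1 : (⨍⁻ z in halfOpenBox b L (a + 1 * h) h, u z ^ q ∂volume) ^ (1 / q) ≤ C ^ 2 * m := by
    have := H b (a + 1 * h)
    rw [show a + 1 * h + h = a + 2 * h by ring] at this
    calc _ ≤ _ := this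
      _ ≤ C * (C * m) := by
        gcongr
        exact (hJ _).trans h2
      _ = _ := by ring
  have h0 : (⨍⁻ z in halfOpenBox b L (a + 0 * h) h, u z ^ q ∂volume) ^ (1 / q) ≤ C ^ 3 * m := by
    have := H b (a + 0 * h)
    rw [show a + 0 * h + h = a + 1 * h by ring] at this
    calc _ ≤ _ := this
      _ ≤ C * (C ^ 2 * m) := by
        gcongr
        exact (hJ _).trans h1
      _ = _ := by ring
  rw [← ENNReal.rpow_inv_le_iff hq0, ← one_div]
  interval_cases k
  · simpa using h0
  · refine (by simpa using h1 : _ ≤ C ^ 2 * m).trans ?_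
    gcongr
    norm_num
  · refine (by simpa using h2 : _ ≤ C * m).trans ?_
    gcongr
    exact le_self_pow₀ hC (by norm_num)

lemma IsWeight.lintegral_halfOpenBox_lt_top {n : ℕ} {w g : (Fin n → ℝ) × ℝ → ℝ} (hw : IsWeight w)
    (hwg : w =ᵐ[volume] g) (b : Fin n → ℝ) (L c h : ℝ) :
    ∫⁻ z in halfOpenBox b L c h, ENNReal.ofReal (g z) < ∞ := by
  have hsub : halfOpenBox b L c h ⊆
      Set.Icc b (fun i => b i + L) ×ˢ Set.Icc c (c + h) := by
    intro z hz
    rw [mem_halfOpenBox] at hz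
    exact ⟨⟨fun i => (hz.1 i).1, fun i => (hz.1 i).2.le⟩, hz.2.1, hz.2.2.le⟩
  have hint : IntegrableOn w (halfOpenBox b L c h) :=
    (hw.1.integrableOn_isCompact (isCompact_Icc.prod isCompact_Icc)).mono_set hsub
  calc _ = ∫⁻ z in halfOpenBox b L c h, ENNReal.ofReal (w z) := by
        refine lintegral_congr_ae (ae_restrict_of_ae ?_)
        filter_upwards [hwg] with z hz
        rw [hz]
    _ < ∞ := Integrable.lintegral_lt_top hint

/-- The self-improvement on one parabolic rectangle. Both of its parts are divided into two halves
in time. On each half of the lower part the local estimate applies, and the averages of `g ^ q`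
that it involves are estimated by the average over the later half of the upper part. -/
lemma ParabolicReverseHolder.laverage_rpow_add_le {n : ℕ} {p q c C₁ ε : ℝ}
    {w g : (Fin n → ℝ) × ℝ → ℝ} (hw : ParabolicReverseHolder p q C₁ w) (hweight : IsWeight w)
    (hp : 1 ≤ p) (hq : 1 < q) (hgm : Measurable g) (hg₀ : ∀ z, 0 ≤ g z) (hwg : w =ᵐ[volume] g)
    (hc₁ : 1 ≤ c) (hc : 16 ^ n * C₁ ≤ c) (hε₀ : 0 < ε) (hε₁ : ε ≤ 1)
    (hε : ε / (q - 1) * (4 * c ^ 2) ^ (q + 1) * 2 ^ (n + 1) * 2 ^ (n + 1) ≤ 1 / 2)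
    (b : Fin n → ℝ) (a : ℝ) {L : ℝ} (hL : 0 < L) :
    (⨍⁻ z in halfOpenBox b L a (L ^ p), ENNReal.ofReal (g z) ^ (q + ε) ∂volume) ^ (1 / (q + ε)) ≤
      ENNReal.ofReal (16 * 4 ^ (n + 1) * c ^ 3) *
        ⨍⁻ z in halfOpenBox b L (a + L ^ p) (L ^ p), ENNReal.ofReal (g z) ∂volume := by
  have hq0 : 0 < q := by linarith
  have hc0 : 0 < c := by linarith
  set u : (Fin n → ℝ) × ℝ → ℝ≥0∞ := fun z => ENNReal.ofReal (g z) with hu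
  have hum : Measurable u := hgm.ennreal_ofReal
  have hLp : 0 < L ^ p := Real.rpow_pos_of_pos hL p
  set h : ℝ := L ^ p / 2 with hh
  have hLph : L ^ p = 2 * h := by rw [hh]; ring
  have hh0 : 0 < h := by positivity
  set V : ℝ≥0∞ := ENNReal.ofReal (L ^ n * h) with hV
  have hV0 : V ≠ 0 := (ENNReal.ofReal_pos.2 (mul_pos (pow_pos hL n) hh0)).ne'
  have hVt : V ≠ ∞ := ENNReal.ofReal_ne_top
  have hgrid : ∀ a' j, BoxReverseHolder u q (ENNReal.ofReal c)
      ((parabolicGrid p hp b a' L hL).side j) ((parabolicGrid p hp b a' L hL).dur j) :=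
    fun a' j => (hw.boxReverseHolder_parabolicGrid hp hq.le hg₀ hwg b a' hL j).mono
      (ENNReal.ofReal_le_ofReal hc)
  have hside : ∀ a', (parabolicGrid p hp b a' L hL).side 0 = L := fun a' => by
    simp [parabolicGrid]
  have hdur : ∀ a', (parabolicGrid p hp b a' L hL).dur 0 = h := fun a' => by
    simp [parabolicGrid, hh]
  have hslab : ∀ a' s, (parabolicGrid p hp b a' L hL).slab s = halfOpenBox b L a' s := by
    intro a' s
    rw [SpaceTimeGrid.slab, hside]
    rfl
  have hvol : ∀ a', (parabolicGrid p hp b a' L hL).vol 0 = V := by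
    intro a'
    rw [SpaceTimeGrid.vol, hside, hdur]
  have H0 : BoxReverseHolder u q (ENNReal.ofReal c) L h := by
    have := hgrid a 0
    rwa [hside, hdur] at this
  set m := ⨍⁻ z in halfOpenBox b L (a + 3 * h) h, u z ∂volume with hm
  have hmt : m ≠ ∞ := by
    rw [hm, laverage_halfOpenBox _ _ hL]
    exact ENNReal.div_ne_top (hweight.lintegral_halfOpenBox_lt_top hwg _ _ _ _).ne hV0
  obtain ⟨r, hr0, hr⟩ : ∃ r : ℝ, 0 ≤ r ∧ m = ENNReal.ofReal r :=
    ⟨m.toReal, ENNReal.toReal_nonneg, (ENNReal.ofReal_toReal hmt).symm⟩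
  have hcr : 0 ≤ c ^ 3 * r := by positivity
  have hslice : ∀ k : ℕ, k ≤ 2 → ∫⁻ z in halfOpenBox b L (a + k * h) h, u z ^ q ≤
      ENNReal.ofReal ((c ^ 3 * r) ^ q) * V := by
    intro k hk
    have := H0.laverage_chain hum hq.le hL hh0 (ENNReal.one_le_ofReal.2 hc₁) b a hk
    rw [laverage_halfOpenBox _ _ hL, ← hV, ENNReal.div_le_iff hV0 hVt, ← hm, hr,
      ← ENNReal.ofReal_pow hc0.le, ← ENNReal.ofReal_mul (by positivity),
      ENNReal.ofReal_rpow_of_nonneg hcr hq0.le] at this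
    exact this
  have hunion : ∀ a', halfOpenBox b L a' (2 * h) ⊆
      halfOpenBox b L a' h ∪ halfOpenBox b L (a' + h) h := by
    intro a' z hz
    simp only [Set.mem_union, mem_halfOpenBox] at hz ⊢
    rcases lt_or_ge z.2 (a' + h) with hlt | hge
    · exact Or.inl ⟨hz.1, hz.2.1, hlt⟩
    · exact Or.inr ⟨hz.1, hge, by linarith [hz.2.2]⟩
  set M : ℝ := 2 * (c ^ 3 * r) ^ q with hM
  have hM0 : 0 ≤ M := by positivity
  have hgain : ∀ k : ℕ, k ≤ 1 → ∫⁻ z in halfOpenBox b L (a + k * h) h, u z ^ (q + ε) ≤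
      ENNReal.ofReal (2 * 4 ^ (n + 1) * M ^ (1 + ε / q)) * V := by
    intro k hk
    have := (parabolicGrid p hp b (a + k * h) L hL).lintegral_slab_rpow_add_le hgm hg₀ hq hc₁
      (hgrid _) hε₀ hε₁ hε hM0 (by
        rw [hslab, hdur, hvol]
        calc _ ≤ _ := lintegral_mono_set (hunion _)
          _ ≤ _ := lintegral_union_le _ _ _
          _ ≤ ENNReal.ofReal ((c ^ 3 * r) ^ q) * V + ENNReal.ofReal ((c ^ 3 * r) ^ q) * V := by
            refine add_le_add (hslice k (by omega)) ?_
            have := hslice (k + 1) (by omega)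
            rwa [show a + ((k + 1 : ℕ) : ℝ) * h = a + k * h + h by push_cast; ring] at this
          _ = _ := by
            rw [hM, ENNReal.ofReal_mul two_pos.le, ENNReal.ofReal_ofNat]
            ring)
    rwa [hslab, hdur, hvol] at this
  have hV2 : ENNReal.ofReal (L ^ n * L ^ p) = 2 * V := by
    rw [hV, hLph, show L ^ n * (2 * h) = 2 * (L ^ n * h) by ring,
      ENNReal.ofReal_mul two_pos.le, ENNReal.ofReal_ofNat]
  have h2V0 : 2 * V ≠ 0 := mul_ne_zero two_ne_zero hV0
  have h2Vt : 2 * V ≠ ∞ := ENNReal.mul_ne_top ENNReal.ofNat_ne_top hVt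
  have hlow : ⨍⁻ z in halfOpenBox b L a (L ^ p), u z ^ (q + ε) ∂volume ≤
      ENNReal.ofReal (2 * 4 ^ (n + 1) * M ^ (1 + ε / q)) := by
    rw [laverage_halfOpenBox _ _ hL, hV2, ENNReal.div_le_iff h2V0 h2Vt, hLph]
    have g0 := hgain 0 (by norm_num)
    have g1 := hgain 1 (by norm_num)
    rw [Nat.cast_zero, zero_mul, add_zero] at g0
    rw [Nat.cast_one, one_mul] at g1
    calc _ ≤ _ := lintegral_mono_set (hunion _)
      _ ≤ _ := lintegral_union_le _ _ _
      _ ≤ _ := add_le_add g0 g1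
      _ = _ := by ring
  have hup : m ≤ 2 * ⨍⁻ z in halfOpenBox b L (a + L ^ p) (L ^ p), u z ∂volume := by
    rw [hm, laverage_halfOpenBox _ _ hL, laverage_halfOpenBox _ _ hL, hV2, ← hV,
      ENNReal.div_le_iff hV0 hVt]
    have hsub : halfOpenBox b L (a + 3 * h) h ⊆ halfOpenBox b L (a + L ^ p) (L ^ p) := by
      intro z hz
      rw [mem_halfOpenBox] at hz ⊢
      exact ⟨hz.1, by linarith [hz.2.1], by linarith [hz.2.2]⟩
    calc _ ≤ _ := lintegral_mono_set hsub
      _ = (∫⁻ z in halfOpenBox b L (a + L ^ p) (L ^ p), u z) / (2 * V) * (2 * V) :=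
        (ENNReal.div_mul_cancel h2V0 h2Vt).symm
      _ = _ := by ring
  have hqε : 0 < q + ε := by linarith
  have hreal : (2 * 4 ^ (n + 1) * M ^ (1 + ε / q)) ≤ (8 * 4 ^ (n + 1) * (c ^ 3 * r)) ^ (q + ε) := by
    have e1 : M ^ (1 + ε / q) = 2 ^ (1 + ε / q) * (c ^ 3 * r) ^ (q + ε) := by
      rw [hM, Real.mul_rpow two_pos.le (by positivity), ← Real.rpow_mul hcr]
      congr 2
      field_simp
    have e2 : (2 : ℝ) ^ (1 + ε / q) ≤ 4 := by
      calc (2 : ℝ) ^ (1 + ε / q) ≤ 2 ^ (2 : ℝ) := by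
            apply Real.rpow_le_rpow_of_exponent_le one_le_two
            have : ε / q ≤ 1 := by
              rw [div_le_one hq0]
              linarith
            linarith
        _ = 4 := by norm_num
    have e3 : (1 : ℝ) ≤ 8 * 4 ^ (n + 1) := by
      have : (1 : ℝ) ≤ 4 ^ (n + 1) := one_le_pow₀ (by norm_num)
      linarith
    have e4 : (8 * 4 ^ (n + 1) : ℝ) ≤ (8 * 4 ^ (n + 1)) ^ (q + ε) := by
      nth_rewrite 1 [← Real.rpow_one (8 * 4 ^ (n + 1) : ℝ)]
      exact Real.rpow_le_rpow_of_exponent_le e3 (by linarith)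
    rw [e1, Real.mul_rpow (by positivity) hcr]
    calc _ ≤ 2 * 4 ^ (n + 1) * (4 * (c ^ 3 * r) ^ (q + ε)) := by gcongr
      _ = 8 * 4 ^ (n + 1) * (c ^ 3 * r) ^ (q + ε) := by ring
      _ ≤ _ := by gcongr
  calc _ ≤ ENNReal.ofReal (8 * 4 ^ (n + 1) * (c ^ 3 * r)) := by
        rw [one_div, ENNReal.rpow_inv_le_iff hqε,
          ENNReal.ofReal_rpow_of_nonneg (by positivity) hqε.le]
        exact hlow.trans (ENNReal.ofReal_le_ofReal hreal)
    _ = ENNReal.ofReal (8 * 4 ^ (n + 1) * c ^ 3) * m := by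
        rw [hr, ← ENNReal.ofReal_mul (by positivity), mul_assoc _ (c ^ 3) r]
    _ ≤ ENNReal.ofReal (8 * 4 ^ (n + 1) * c ^ 3) *
          (2 * ⨍⁻ z in halfOpenBox b L (a + L ^ p) (L ^ p), u z ∂volume) := by gcongr
    _ = _ := by
        rw [show (16 * 4 ^ (n + 1) * c ^ 3 : ℝ) = (8 * 4 ^ (n + 1) * c ^ 3) * 2 by ring,
          ENNReal.ofReal_mul (q := 2) (by positivity), ENNReal.ofReal_ofNat]
        exact (mul_assoc _ _ _).symm

/-- The quantitative form of the self-improvement, in which neither `ε` nor `C` depends on `p`. -/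
lemma exists_parabolicReverseHolder_add (n : ℕ) {q : ℝ} (hq : 1 < q) (C₁ : ℝ) :
    ∃ ε : ℝ, 0 < ε ∧ ∃ C : ℝ, 0 < C ∧
      ∀ p : ℝ, 1 ≤ p → ∀ w : (Fin n → ℝ) × ℝ → ℝ, IsWeight w →
        ParabolicReverseHolder p q C₁ w → ParabolicReverseHolder p (q + ε) C w := by
  have hq1 : 0 < q - 1 := by linarith
  set c : ℝ := max 1 (16 ^ n * C₁) with hc
  have hc1 : 1 ≤ c := le_max_left _ _
  have hc0 : 0 < c := by linarith
  set D : ℝ := (4 * c ^ 2) ^ (q + 1) * 2 ^ (n + 1) * 2 ^ (n + 1) with hD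
  have hD0 : 0 < D := by positivity
  -- `ε` is so small that the last term of the iterated inequality can be absorbed
  set ε : ℝ := min 1 ((q - 1) / (2 * D)) with hε
  have hε0 : 0 < ε := lt_min one_pos (by positivity)
  have hεD : ε / (q - 1) * (4 * c ^ 2) ^ (q + 1) * 2 ^ (n + 1) * 2 ^ (n + 1) ≤ 1 / 2 := by
    calc _ = ε / (q - 1) * D := by rw [hD]; ring
      _ ≤ (q - 1) / (2 * D) / (q - 1) * D := by
        gcongr
        exact min_le_right _ _
      _ = 1 / 2 := by field_simp
  refine ⟨ε, hε0, 16 * 4 ^ (n + 1) * c ^ 3, by positivity, fun p hp w hw hRH x t L hL => ?_⟩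
  have hsm := hw.1.aestronglyMeasurable
  set g : (Fin n → ℝ) × ℝ → ℝ := fun z => max (hsm.mk w z) 0 with hg
  have hgm : Measurable g := hsm.stronglyMeasurable_mk.measurable.max measurable_const
  have hg0 : ∀ z, 0 ≤ g z := fun z => le_max_right _ _
  have hwg : w =ᵐ[volume] g := by
    filter_upwards [hsm.ae_eq_mk] with z hz
    rw [hg]
    simp only
    rw [← hz, max_eq_left (hw.2 z)]
  have key := hRH.laverage_rpow_add_le hw hp hq hgm hg0 hwg hc1 (le_max_right _ _) hε0
    (min_le_left _ _) hεD (fun i => x i - L / 2) (t - L ^ p) hL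
  rw [sub_add_cancel, setLAverage_congr (halfOpenBox_ae_eq_lowerRect p x t L),
    setLAverage_congr (halfOpenBox_ae_eq_upperRect p x t L)] at key
  have e1 : ⨍⁻ z in lowerRect p x t L, ENNReal.ofReal (w z ^ (q + ε)) ∂volume =
      ⨍⁻ z in lowerRect p x t L, ENNReal.ofReal (g z) ^ (q + ε) ∂volume := by
    refine laverage_congr (ae_restrict_of_ae ?_)
    filter_upwards [hwg] with z hz
    rw [hz, ENNReal.ofReal_rpow_of_nonneg (hg0 z) (by linarith)]
  have e2 : ⨍⁻ z in upperRect p x t L, ENNReal.ofReal (w z) ∂volume =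
      ⨍⁻ z in upperRect p x t L, ENNReal.ofReal (g z) ∂volume := by
    refine laverage_congr (ae_restrict_of_ae ?_)
    filter_upwards [hwg] with z hz
    rw [hz]
  rwa [e1, e2]

theorem mainTheorem2 (n : ℕ) (q : ℝ) (hq : 1 < q) :
    (∀ C₁ : ℝ, 0 < C₁ →
      ∃ ε : ℝ, 0 < ε ∧ ∃ C : ℝ, 0 < C ∧
        ∀ p : ℝ, 1 ≤ p → ∀ w : (Fin n → ℝ) × ℝ → ℝ, IsWeight w →
          ParabolicReverseHolder p q C₁ w → ParabolicReverseHolder p (q + ε) C w) ∧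
    (∀ p : ℝ, 1 ≤ p → ∀ w ∈ RHPlus n p q, ∃ ε : ℝ, 0 < ε ∧ w ∈ RHPlus n p (q + ε)) := by
  refine ⟨fun C₁ _ => exists_parabolicReverseHolder_add n hq C₁, ?_⟩
  rintro p hp w ⟨hw, C₁, -, hRH⟩
  obtain ⟨ε, hε, C, hC, h⟩ := exists_parabolicReverseHolder_add n hq C₁
  exact ⟨ε, hε, hw, C, hC, h p hp w hw hRH⟩
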